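/- Let $n\ge 0$ and $l$ be integers with $2l>n$, and let $V(x)=\sum_{q\in\mathbb Z^n}v_q e^{i\langle q,x\rangle}$ be a real trigonometric polynomial on $\mathbb R^n$ (finitely many $v_q\ne0$, $v_{-q}=\overline{v_q}$) with $v_0=0$. Notation. $K=[0,1)^n$; $P_j(t)=j+t$ and $p_j(t)=|P_j(t)|$ for $j\in\mathbb Z^n$, $t\in\mathbb R^n$; $\mathcal K:\mathbb R^n\to K$ is the map $\mathcal K P_j(t)=t$ for $t\in K$. For $k>0$, $\delta>0$ and $q\in\mathbb Z^n$, the resonant set $\chi_q(k,\delta)$ consists of all $t$ in the image under $\mathcal K$ of $\{x\in\mathbb R^n: |x|=k,\ \big||x|^2-|x-q|^2\big|<4k^{-n+2-\delta}\}$ for which there is a $j\in\mathbb Z^n$ (a resonant index of $t$) with $$p_j(t)=k,\qquad |p_{j-q}^2(t)-p_j^2(t)|<k^{-n+2-\delta},\qquad |p_j^2(t)-p_i^2(t)|>2k^{-n+2-6\delta}\ \text{ for all } i\ne j,\,j-q .$$ For $t\in K$ and $j\in\mathbb Z^n$ let $$\hat\lambda^+(t)=\tfrac12\big(p_j^{2l}(t)+p_{j-q}^{2l}(t)\big)+\tfrac12\Big(4|v_q|^2+\big(p_j^{2l}(t)-p_{j-q}^{2l}(t)\big)^2\Big)^{1/2}$$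 be the larger eigenvalue of the model matrix $\begin{pmatrix}p_j^{2l}(t)&v_q\\ v_{-q}&p_{j-q}^{2l}(t)\end{pmatrix}$, let $\hat e^+=(p_{j-q}^{2l}(t)-\hat\lambda^+(t),\,-v_{-q})^T$ be a corresponding eigenvector, let $\hat E^+=\hat e^+(\hat e^+)^*/|\hat e^+|^2$ be the spectral projection, with rows and columns indexed by $j,\,j-q$, and let $$\psi_{-1}(x)=\hat E^+_{j,j}+\hat E^+_{j-q,j}\,e^{-i\langle q,x\rangle}.$$ For a function $f$ on $\mathbb R^n$ that is $2\pi$-periodic in each variable, $\|f\|_*$ is the sum of the absolute values of its Fourier coefficients. Theorem. There is a constant $\hat c=\hat c(V,l)>0$, and for every $\delta$ with $0<9\delta<2l-n$ there is a $k_0=k_0(V,l,\delta)\ge1$, such that the following holds for all $k>k_0$ and all $q$ with $v_q\ne0$. Let $t\in K$ lie at distance less than $k^{-n+1-7\delta}$ from a point $t_0\in\chi_q(k,\delta)$, let $j$ be a resonant index of $t_0$, let $\gamma_2>0$, and let $\sigma\in\mathbb R$, $A\in\mathbb C$ satisfy $|\sigma||A|^2<k^{-2l\gamma_2}$. Put $\gamma=\min\{\gamma_1,2l\gamma_2\}$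 with $2\gamma_1=2l-n-8\delta$. Then there are a function $u\in C^{2l}(\mathbb R^n)$ and a real number $\lambda$ with $$(-\Delta)^l u+Vu+\sigma|u|^2u=\lambda u\quad\text{in }\mathbb R^n,$$ $$\frac{\partial^m u}{\partial x_s^m}(x+2\pi e_s)=e^{2\pi i t_s}\frac{\partial^m u}{\partial x_s^m}(x)\qquad(x\in\mathbb R^n,\ 1\le s\le n,\ 0\le m\le 2l-1),$$ such that $$u(x)=A\,e^{i\langle P_j(t),x\rangle}\big(\psi_{-1}(x)+\hat u(x)\big),\qquad |\lambda-\hat\lambda^+(t)|\le\hat c\,k^{-\gamma},$$ where $\hat u$ is continuous, $2\pi$-periodic in each variable, and $\|\hat u\|_*\le\hat c\,k^{-\gamma}$. -/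

import Mathlib

open scoped ENNReal

noncomputable section

namespace Polyharmonic

/-- The lattice vector `j ∈ ℤⁿ`, seen in `ℝⁿ`. -/
def latticePoint {n : ℕ} (j : Fin n → ℤ) : EuclideanSpace ℝ (Fin n) :=
  WithLp.toLp 2 (fun i => (j i : ℝ))

/-- `P_j(t) = j + t`. -/
def shiftedPoint {n : ℕ} (j : Fin n → ℤ) (t : EuclideanSpace ℝ (Fin n)) :
    EuclideanSpace ℝ (Fin n) :=
  latticePoint j + t

/-- The elementary cell `K = [0,1)ⁿ` of the dual lattice. -/
def dualCell (n : ℕ) : Set (EuclideanSpace ℝ (Fin n)) :=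
  {t | ∀ i, t i ∈ Set.Ico (0 : ℝ) 1}

/-- The map `𝒦 : ℝⁿ → K`, `𝒦 (P_j(t)) = t`. -/
def toDualCell {n : ℕ} (x : EuclideanSpace ℝ (Fin n)) : EuclideanSpace ℝ (Fin n) :=
  WithLp.toLp 2 (fun i => Int.fract (x i))

/-- The eigenvalue `p_j^{2l}(t) = |P_j(t)|^{2l}` of the free operator `H₀(t)`. -/
def freeEigenvalue {n : ℕ} (l : ℕ) (j : Fin n → ℤ) (t : EuclideanSpace ℝ (Fin n)) : ℝ :=
  ‖shiftedPoint j t‖ ^ (2 * l)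

/-- The plane wave `x ↦ e^{i⟨p, x⟩}`. -/
def planeWave {n : ℕ} (p x : EuclideanSpace ℝ (Fin n)) : ℂ :=
  Complex.exp (Complex.I * ((inner ℝ p x : ℝ) : ℂ))

/-- The trigonometric polynomial `V(x) = ∑_q v_q e^{i⟨q, x⟩}` with coefficients `v`. -/
def potential {n : ℕ} (v : (Fin n → ℤ) →₀ ℂ) (x : EuclideanSpace ℝ (Fin n)) : ℂ :=
  v.sum (fun q a => a * planeWave (latticePoint q) x)

/-- The spherical layer
`S_q(k, ε) = {x : |x| = k, | |x|² - |x - q|² | < 4 k^{-ε}}`. -/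
def sphericalLayer {n : ℕ} (q : Fin n → ℤ) (k ε : ℝ) : Set (EuclideanSpace ℝ (Fin n)) :=
  {x | ‖x‖ = k ∧ |‖x‖ ^ 2 - ‖x - latticePoint q‖ ^ 2| < 4 * k ^ (-ε)}

/-- `j` is a resonant index for the quasimomentum `t`: the point `P_j(t)` is on the sphere of
radius `k`, `p_{j-q}²(t)` is close to `p_j²(t)`, and all the other `p_i²(t)` are away from it. -/
structure IsResonantIndex {n : ℕ} (q : Fin n → ℤ) (k δ : ℝ) (t : EuclideanSpace ℝ (Fin n))
    (j : Fin n → ℤ) : Prop where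
  norm_eq : ‖shiftedPoint j t‖ = k
  close : |‖shiftedPoint (j - q) t‖ ^ 2 - ‖shiftedPoint j t‖ ^ 2| < k ^ (-(n : ℝ) + 2 - δ)
  far : ∀ i : Fin n → ℤ, i ≠ j → i ≠ j - q →
    2 * k ^ (-(n : ℝ) + 2 - 6 * δ) < |‖shiftedPoint j t‖ ^ 2 - ‖shiftedPoint i t‖ ^ 2|

/-- The resonant set `χ_q(k, δ)`, a subset of `𝒦 S_q(k, n - 2 + δ) ⊆ K`. -/
def resonantSet {n : ℕ} (q : Fin n → ℤ) (k δ : ℝ) : Set (EuclideanSpace ℝ (Fin n)) :=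
  {t | t ∈ toDualCell '' sphericalLayer q k ((n : ℝ) - 2 + δ) ∧
    ∃ j : Fin n → ℤ, IsResonantIndex q k δ t j}

/-- The larger eigenvalue `λ̂⁺(t)` of the model matrix
`!![p_j^{2l}(t), v_q; v_{-q}, p_{j-q}^{2l}(t)]` (for `v_{-q}` conjugate to `v_q`). -/
def lambdaPlus {n : ℕ} (l : ℕ) (v : (Fin n → ℤ) →₀ ℂ) (q j : Fin n → ℤ)
    (t : EuclideanSpace ℝ (Fin n)) : ℝ :=
  (freeEigenvalue l j t + freeEigenvalue l (j - q) t) / 2 +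
    Real.sqrt (4 * ‖v q‖ ^ 2 + (freeEigenvalue l j t - freeEigenvalue l (j - q) t) ^ 2) / 2

/-- The eigenvector `ê⁺ = (p_{j-q}^{2l}(t) - λ̂⁺(t), -v_{-q})` of the model matrix. -/
def modelEigenvector {n : ℕ} (l : ℕ) (v : (Fin n → ℤ) →₀ ℂ) (q j : Fin n → ℤ)
    (t : EuclideanSpace ℝ (Fin n)) : Fin 2 → ℂ :=
  ![((freeEigenvalue l (j - q) t - lambdaPlus l v q j t : ℝ) : ℂ), -v (-q)]

/-- The block of `Ê⁺(t)` with indices in `{j, j - q}` (in this order), that is, the orthogonal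
projection `ê ê* / |ê|²` onto the line spanned by `ê = ê⁺`; all other entries of `Ê⁺(t)` are `0`. -/
def modelProjection {n : ℕ} (l : ℕ) (v : (Fin n → ℤ) →₀ ℂ) (q j : Fin n → ℤ)
    (t : EuclideanSpace ℝ (Fin n)) : Matrix (Fin 2) (Fin 2) ℂ :=
  ((∑ a, ‖modelEigenvector l v q j t a‖ ^ 2 : ℝ) : ℂ)⁻¹ •
    Matrix.vecMulVec (modelEigenvector l v q j t) (star (modelEigenvector l v q j t))

/-- `ψ₋₁(x) = Ê⁺(t)_{j,j} + Ê⁺(t)_{j-q,j} e^{-i⟨q, x⟩}`, so that `e^{i⟨P_j(t), x⟩} ψ₋₁(x)` is the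
combination of the plane waves with wave vectors `P_j(t)`, `P_{j-q}(t)` whose coefficients are the
column of `Ê⁺(t)` with index `j`. -/
def psiModel {n : ℕ} (l : ℕ) (v : (Fin n → ℤ) →₀ ℂ) (q j : Fin n → ℤ)
    (t x : EuclideanSpace ℝ (Fin n)) : ℂ :=
  modelProjection l v q j t 0 0 +
    modelProjection l v q j t 1 0 * planeWave (-latticePoint q) x

/-- `(-Δ)^l u`. -/
def polyLaplacian {n : ℕ} (l : ℕ) (u : EuclideanSpace ℝ (Fin n) → ℂ) :
    EuclideanSpace ℝ (Fin n) → ℂ :=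
  (fun f : EuclideanSpace ℝ (Fin n) → ℂ => -Laplacian.laplacian f)^[l] u

/-- `u` is a classical solution in `ℝⁿ` of `(-Δ)^l u + V u + σ |u|² u = lam u`. -/
def IsSolution {n : ℕ} (l : ℕ) (V : EuclideanSpace ℝ (Fin n) → ℂ) (σ lam : ℝ)
    (u : EuclideanSpace ℝ (Fin n) → ℂ) : Prop :=
  ContDiff ℝ (2 * l : ℕ) u ∧
    ∀ x, polyLaplacian l u x + V x * u x + (σ : ℂ) * ((‖u x‖ ^ 2 : ℝ) : ℂ) * u x = (lam : ℂ) * u x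

/-- The quasi-periodic conditions with quasimomentum `t`: for every coordinate direction `s`, `u`
and its derivatives `∂^m u / ∂x_s^m`, `m ≤ 2l - 1`, are multiplied by `e^{2πi t_s}` when `x_s` is
replaced by `x_s + 2π`. -/
def IsQuasiPeriodic {n : ℕ} (l : ℕ) (t : EuclideanSpace ℝ (Fin n))
    (u : EuclideanSpace ℝ (Fin n) → ℂ) : Prop :=
  ∀ (s : Fin n) (m : ℕ), m < 2 * l → ∀ x : EuclideanSpace ℝ (Fin n),
    iteratedFDeriv ℝ m u (x + EuclideanSpace.single s (2 * Real.pi))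
        (fun _ => EuclideanSpace.single s 1) =
      Complex.exp (2 * Real.pi * Complex.I * (t s : ℂ)) *
        iteratedFDeriv ℝ m u x (fun _ => EuclideanSpace.single s 1)

/-- `f` is `2π`-periodic in every coordinate. -/
def IsPeriodic {n : ℕ} (f : EuclideanSpace ℝ (Fin n) → ℂ) : Prop :=
  ∀ (s : Fin n) (x : EuclideanSpace ℝ (Fin n)),
    f (x + EuclideanSpace.single s (2 * Real.pi)) = f x

/-- The Fourier coefficient `(2π)⁻ⁿ ∫_Q f(x) e^{-i⟨b, x⟩} dx`, where `Q = [0, 2π]ⁿ`. -/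
def fourierCoefficient {n : ℕ} (f : EuclideanSpace ℝ (Fin n) → ℂ) (b : Fin n → ℤ) : ℂ :=
  (((2 * Real.pi) ^ n : ℝ) : ℂ)⁻¹ *
    ∫ x in {x : EuclideanSpace ℝ (Fin n) | ∀ i, x i ∈ Set.Icc 0 (2 * Real.pi)},
      f x * planeWave (-latticePoint b) x

/-- `‖f‖_* = ∑_b |f_b|`, the sum of the absolute values of the Fourier coefficients. -/
def starNorm {n : ℕ} (f : EuclideanSpace ℝ (Fin n) → ℂ) : ℝ≥0∞ :=
  ∑' b : Fin n → ℤ, ‖fourierCoefficient f b‖ₑ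

end Polyharmonic

end

/-!
In Fourier coefficients relative to `e^{i⟨P_j(t), x⟩}` the equation reads `D Y + v ∗ Y + τ Y ∗ Ȳ ∗ Y
= λ Y` in `ℓ¹(ℤⁿ)`, where `D` is diagonal with entries `p_{j+m}^{2l}(t)` and `τ = σ |A β|²` for a
scalar `β`. Resonance means that all entries of `D` except those with indices `0` and `-q` are far
from `p_j^{2l}(t)`.

If `p_{j-q}^{2l}(t)` is at most moderately larger than `p_j^{2l}(t)`, then `D - λ̂⁺` has a small
inverse off these two indices. The equation is solved by Lyapunov–Schmidt reduction around a unit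
eigenvector `e` of the model block, whose two eigenvalues differ by at least `2 |v_q|`. The other
coordinates act on the block only through their own, small, values, so the reduced map is a
contraction although `v` is not small. The resulting `λ` is real because `D + v ∗ + τ Y ∗ Ȳ ∗` is
symmetric, and `u` is normalized by `β = conj e₀`.

If `p_{j-q}^{2l}(t)` is much larger than `p_j^{2l}(t)`, then `e` is concentrated at the index `-q`,
the column `ψ₋₁` of `Ê⁺` is itself within the error, and `u = 0` serves.
-/

noncomputable section

open scoped lp ComplexConjugate

namespace Polyharmonic

/-! ### The convolution algebra `ℓ¹` -/

section LinearCombination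

variable {ι E : Type*} [NormedAddCommGroup E] [NormedSpace ℂ E] [CompleteSpace E]
  {F : ι → E} {C : ℝ}

theorem hasSum_norm_apply (Y : ℓ¹(ι, ℂ)) : HasSum (fun m => ‖Y m‖) ‖Y‖ := by
  simpa using lp.hasSum_norm (p := 1) (by simp) Y

theorem norm_apply_add_norm_apply_le (Y : ℓ¹(ι, ℂ)) {m p : ι} (h : m ≠ p) :
    ‖Y m‖ + ‖Y p‖ ≤ ‖Y‖ := by
  classical
  simpa [Finset.sum_pair h] using
    sum_le_hasSum {m, p} (fun i _ => norm_nonneg (Y i)) (hasSum_norm_apply Y)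

/-- The continuous linear extension `Y ↦ ∑ₘ Yₘ Fₘ` to `ℓ¹` of a bounded family `F` of vectors. -/
def linearCombination (F : ι → E) (hC : 0 ≤ C) (hF : ∀ m, ‖F m‖ ≤ C) : ℓ¹(ι, ℂ) →L[ℂ] E :=
  (lp.tsumCLM ℂ ι E).comp
    (lp.mapCLM 1 (fun m => ContinuousLinearMap.toSpanSingleton ℂ (F m)) hC
      fun m => (ContinuousLinearMap.norm_toSpanSingleton (F m)).trans_le (hF m))

theorem norm_linearCombination_le (hC : 0 ≤ C) (hF : ∀ m, ‖F m‖ ≤ C) :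
    ‖linearCombination F hC hF‖ ≤ C :=
  calc ‖linearCombination F hC hF‖
    _ ≤ 1 * C := (ContinuousLinearMap.opNorm_comp_le _ _).trans
        (mul_le_mul lp.norm_tsumCLM_le (lp.norm_mapCLM_le _ _ _ _) (norm_nonneg _) zero_le_one)
    _ = C := one_mul C

theorem linearCombination_single [DecidableEq ι] (hC : 0 ≤ C) (hF : ∀ m, ‖F m‖ ≤ C) (m : ι)
    (c : ℂ) : linearCombination F hC hF (lp.single 1 m c) = c • F m :=
  (tsum_eq_single m fun p hp => by simp [hp]).trans (by simp)

theorem hasSum_linearCombination (hC : 0 ≤ C) (hF : ∀ m, ‖F m‖ ≤ C) (Y : ℓ¹(ι, ℂ)) :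
    HasSum (fun m => Y m • F m) (linearCombination F hC hF Y) := by
  classical
  simpa only [linearCombination_single] using
    (lp.hasSum_single (p := 1) ENNReal.one_ne_top Y).mapL (linearCombination F hC hF)

end LinearCombination

section Multiplier

variable {ι : Type*} {w : ι → ℂ} {C : ℝ}

/-- The diagonal operator on `ℓ¹` which multiplies the coordinates by a bounded family `w`. -/
def diagonal (w : ι → ℂ) (hC : 0 ≤ C) (hw : ∀ m, ‖w m‖ ≤ C) : ℓ¹(ι, ℂ) →L[ℂ] ℓ¹(ι, ℂ) :=
  lp.mapCLM 1 (fun m => ContinuousLinearMap.mul ℂ ℂ (w m)) hC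
    fun m => (ContinuousLinearMap.opNorm_mul_apply ℂ ℂ (w m)).trans_le (hw m)

@[simp]
theorem diagonal_apply (hC : 0 ≤ C) (hw : ∀ m, ‖w m‖ ≤ C) (Y : ℓ¹(ι, ℂ)) (m : ι) :
    diagonal w hC hw Y m = w m * Y m := rfl

theorem norm_diagonal_le (hC : 0 ≤ C) (hw : ∀ m, ‖w m‖ ≤ C) : ‖diagonal w hC hw‖ ≤ C :=
  lp.norm_mapCLM_le _ _ _ _

/-- The `ℓ¹` pairing `∑ₘ conj (Yₘ) Zₘ`, as a functional of `Z`. -/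
def pairing (Y : ℓ¹(ι, ℂ)) : ℓ¹(ι, ℂ) →L[ℂ] ℂ :=
  linearCombination (fun m => conj (Y m)) (norm_nonneg Y) fun m => by
    simpa using lp.norm_apply_le_norm one_ne_zero Y m

theorem hasSum_pairing (Y Z : ℓ¹(ι, ℂ)) : HasSum (fun m => Z m * conj (Y m)) (pairing Y Z) :=
  hasSum_linearCombination _ _ Z

/-- Relabelling of the coordinates by a permutation of the index set. -/
def reindex (e : Equiv.Perm ι) : ℓ¹(ι, ℂ) →ₗᵢ[ℂ] ℓ¹(ι, ℂ) where
  toFun Y := ⟨fun p => Y (e.symm p), memℓp_gen (by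
    simpa [Function.comp_def] using e.symm.summable_iff.2 (hasSum_norm_apply Y).summable)⟩
  map_add' _ _ := rfl
  map_smul' _ _ := rfl
  norm_map' Y := (hasSum_norm_apply _).unique (e.symm.hasSum_iff.2 (hasSum_norm_apply Y))

end Multiplier

section Convolution

variable {ι : Type*} [AddCommGroup ι]

/-- Translation of the index by `m`, on Fourier coefficients the multiplication by a plane wave. -/
def shift (m : ι) : ℓ¹(ι, ℂ) →ₗᵢ[ℂ] ℓ¹(ι, ℂ) :=
  reindex (Equiv.addRight m)

@[simp]
theorem shift_apply (m : ι) (Y : ℓ¹(ι, ℂ)) (p : ι) : shift m Y p = Y (p - m) := by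
  rw [sub_eq_add_neg]; rfl

/-- Convolution `Y ∗ Z = ∑ₘ Yₘ Z(· - m)`, on Fourier coefficients the product of functions. -/
def conv : ℓ¹(ι, ℂ) →L[ℂ] ℓ¹(ι, ℂ) →L[ℂ] ℓ¹(ι, ℂ) :=
  linearCombination (fun m => (shift m).toContinuousLinearMap) zero_le_one
    fun m => (shift m).norm_toContinuousLinearMap_le

theorem hasSum_conv (Y Z : ℓ¹(ι, ℂ)) : HasSum (fun m => Y m • shift m Z) (conv Y Z) :=
  (hasSum_linearCombination zero_le_one
    (fun m : ι => (shift m).norm_toContinuousLinearMap_le) Y).mapL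
      (ContinuousLinearMap.apply ℂ ℓ¹(ι, ℂ) Z)

theorem hasSum_conv_apply (Y Z : ℓ¹(ι, ℂ)) (p : ι) :
    HasSum (fun m => Y m * Z (p - m)) (conv Y Z p) := by
  have h : HasSum (fun m => (Y m • shift m Z) p) (conv Y Z p) :=
    (hasSum_conv Y Z).mapL (lp.evalCLM ℂ (fun _ => ℂ) 1 p)
  simpa using h

theorem norm_conv_le (Y : ℓ¹(ι, ℂ)) : ‖conv Y‖ ≤ ‖Y‖ := by
  simpa using conv.le_of_opNorm_le (norm_linearCombination_le _ _) Y

theorem norm_conv_apply_le (Y Z : ℓ¹(ι, ℂ)) : ‖conv Y Z‖ ≤ ‖Y‖ * ‖Z‖ :=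
  (conv Y).le_of_opNorm_le (norm_conv_le Y) Z

theorem conv_comm (Y Z : ℓ¹(ι, ℂ)) : conv Y Z = conv Z Y := by
  ext p
  refine (hasSum_conv_apply Y Z p).unique ?_
  simpa [Function.comp_def, mul_comm] using
    (Equiv.subLeft p).hasSum_iff.2 (hasSum_conv_apply Z Y p)

theorem conv_single_apply [DecidableEq ι] (Y : ℓ¹(ι, ℂ)) (s : ι) (x : ℂ) (p : ι) :
    conv Y (lp.single 1 s x) p = Y (p - s) * x := by
  rw [conv_comm, conv, linearCombination_single]
  simp [mul_comm]

/-- The coefficients `conj (Y₋ₚ)` of the complex conjugate of the function with coefficients `Y`. -/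
def conjCoeff (Y : ℓ¹(ι, ℂ)) : ℓ¹(ι, ℂ) :=
  star (reindex (Equiv.neg ι) Y)

@[simp]
theorem conjCoeff_apply (Y : ℓ¹(ι, ℂ)) (p : ι) : conjCoeff Y p = conj (Y (-p)) := rfl

theorem conjCoeff_conjCoeff (Y : ℓ¹(ι, ℂ)) : conjCoeff (conjCoeff Y) = Y := by
  ext p; simp

theorem norm_conjCoeff (Y : ℓ¹(ι, ℂ)) : ‖conjCoeff Y‖ = ‖Y‖ :=
  (norm_star _).trans ((reindex _).norm_map Y)

theorem conjCoeff_add (Y Z : ℓ¹(ι, ℂ)) : conjCoeff (Y + Z) = conjCoeff Y + conjCoeff Z := by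
  ext p; simp

theorem conjCoeff_sub (Y Z : ℓ¹(ι, ℂ)) : conjCoeff (Y - Z) = conjCoeff Y - conjCoeff Z := by
  ext p; simp

theorem conjCoeff_smul (c : ℂ) (Y : ℓ¹(ι, ℂ)) : conjCoeff (c • Y) = conj c • conjCoeff Y := by
  ext p; simp

theorem conjCoeff_conv (Y Z : ℓ¹(ι, ℂ)) :
    conjCoeff (conv Y Z) = conv (conjCoeff Y) (conjCoeff Z) := by
  ext p
  refine HasSum.unique ?_ (hasSum_conv_apply (conjCoeff Y) (conjCoeff Z) p)
  have h := (Equiv.neg ι).hasSum_iff.2 (Complex.hasSum_conj'.2 (hasSum_conv_apply Y Z (-p)))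
  simpa [Function.comp_def, sub_eq_add_neg, add_comm] using h

theorem hasSum_pairing_conv (W Y Z : ℓ¹(ι, ℂ)) :
    HasSum (fun m => W m * pairing Y (shift m Z)) (pairing Y (conv W Z)) := by
  simpa using (hasSum_conv W Z).mapL (pairing Y)

theorem conj_pairing_shift (Y : ℓ¹(ι, ℂ)) (m : ι) :
    conj (pairing Y (shift m Y)) = pairing Y (shift (-m) Y) := by
  refine HasSum.unique ?_ (hasSum_pairing Y (shift (-m) Y))
  have h := (Equiv.addRight m).hasSum_iff.2
    (Complex.hasSum_conj'.2 (hasSum_pairing Y (shift m Y)))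
  simpa [Function.comp_def, mul_comm] using h

theorem im_pairing_conv_eq_zero {W : ℓ¹(ι, ℂ)} (hW : conjCoeff W = W) (Y : ℓ¹(ι, ℂ)) :
    (pairing Y (conv W Y)).im = 0 := by
  have hWneg (m : ι) : conj (W (-m)) = W m := by rw [← conjCoeff_apply, hW]
  refine Complex.conj_eq_iff_im.1 (HasSum.unique ?_ (hasSum_pairing_conv W Y Y))
  have h := (Equiv.neg ι).hasSum_iff.2 (Complex.hasSum_conj'.2 (hasSum_pairing_conv W Y Y))
  simpa [Function.comp_def, hWneg, conj_pairing_shift] using h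

/-- The coefficients of `|f|² f`, for the function `f` with coefficients `Y`. -/
def cubic (Y : ℓ¹(ι, ℂ)) : ℓ¹(ι, ℂ) := conv (conv Y (conjCoeff Y)) Y

theorem norm_conv_conv_conjCoeff_le {Y Z U : ℓ¹(ι, ℂ)} {ρ₁ ρ₂ ρ₃ : ℝ} (hY : ‖Y‖ ≤ ρ₁)
    (hZ : ‖Z‖ ≤ ρ₂) (hU : ‖U‖ ≤ ρ₃) : ‖conv (conv Y (conjCoeff Z)) U‖ ≤ ρ₁ * ρ₂ * ρ₃ :=
  calc ‖conv (conv Y (conjCoeff Z)) U‖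
    _ ≤ ‖Y‖ * ‖conjCoeff Z‖ * ‖U‖ :=
        (norm_conv_apply_le _ _).trans (by gcongr; exact norm_conv_apply_le _ _)
    _ ≤ ρ₁ * ρ₂ * ρ₃ := by
        rw [norm_conjCoeff]
        have := (norm_nonneg Y).trans hY
        have := (norm_nonneg Z).trans hZ
        gcongr

theorem norm_cubic_le {Y : ℓ¹(ι, ℂ)} {ρ : ℝ} (hY : ‖Y‖ ≤ ρ) : ‖cubic Y‖ ≤ ρ ^ 3 :=
  (norm_conv_conv_conjCoeff_le hY hY hY).trans_eq (by ring)

theorem norm_cubic_sub_le {Y Z : ℓ¹(ι, ℂ)} {ρ : ℝ} (hY : ‖Y‖ ≤ ρ) (hZ : ‖Z‖ ≤ ρ) :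
    ‖cubic Y - cubic Z‖ ≤ 3 * ρ ^ 2 * ‖Y - Z‖ := by
  have telescope : cubic Y - cubic Z =
      conv (conv Y (conjCoeff Y)) (Y - Z) + conv (conv Y (conjCoeff (Y - Z))) Z +
        conv (conv (Y - Z) (conjCoeff Z)) Z := by
    simp only [cubic, map_sub, conjCoeff_sub, sub_apply]
    abel
  rw [telescope]
  refine norm_add₃_le.trans ?_
  linarith [norm_conv_conv_conjCoeff_le hY hY (le_refl ‖Y - Z‖),
    norm_conv_conv_conjCoeff_le hY (le_refl ‖Y - Z‖) hZ,
    norm_conv_conv_conjCoeff_le (le_refl ‖Y - Z‖) hZ hZ]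

theorem norm_smul_cubic_add_sub_le (τ : ℝ) {E x y : ℓ¹(ι, ℂ)} (hE : ‖E‖ ≤ 2) (hx : ‖x‖ ≤ 1)
    (hy : ‖y‖ ≤ 1) :
    ‖(τ : ℂ) • cubic (E + x) - (τ : ℂ) • cubic (E + y)‖ ≤ 27 * |τ| * ‖x - y‖ := by
  have hcubic := norm_cubic_sub_le (norm_add_le_of_le hE hx) (norm_add_le_of_le hE hy)
  rw [add_sub_add_left_eq_sub] at hcubic
  rw [← smul_sub, norm_smul, Complex.norm_real, Real.norm_eq_abs]
  linarith [mul_le_mul_of_nonneg_left hcubic (abs_nonneg τ)]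

end Convolution

/-! ### Real eigenvalues -/

theorem im_eq_zero_of_eigenvector {ι : Type*} [AddCommGroup ι] {a : ι → ℝ} {lam : ℂ}
    {W Y : ℓ¹(ι, ℂ)} (hW : conjCoeff W = W)
    (h : ∀ m, (a m : ℂ) * Y m + conv W Y m = lam * Y m) (hY : Y ≠ 0) : lam.im = 0 := by
  have hterm (m : ι) : (conv W Y m * conj (Y m)).im = lam.im * ‖Y m‖ ^ 2 := by
    have : conv W Y m * conj (Y m) = (lam - a m) * (‖Y m‖ ^ 2 : ℝ) := by
      rw [Complex.ofReal_pow, ← Complex.mul_conj']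
      linear_combination conj (Y m) * h m
    rw [this, Complex.im_mul_ofReal]; simp
  have hsum : HasSum (fun m => lam.im * ‖Y m‖ ^ 2) 0 := by
    simpa only [hterm, im_pairing_conv_eq_zero hW Y] using
      Complex.hasSum_im (hasSum_pairing Y (conv W Y))
  by_contra hne
  have hzero : HasSum (fun m => ‖Y m‖ ^ 2) 0 := by
    simpa [hne] using hsum.mul_left lam.im⁻¹
  refine hY (lp.ext (funext fun m => ?_))
  simpa using congrFun ((hasSum_zero_iff_of_nonneg fun m => sq_nonneg ‖Y m‖).1 hzero) m

theorem im_eq_zero_of_cubic_eigenvector {ι : Type*} [AddCommGroup ι] {a : ι → ℝ} {τ : ℝ} {lam : ℂ}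
    {v Y : ℓ¹(ι, ℂ)} (hv : conjCoeff v = v)
    (h : ∀ m, a m * Y m + conv v Y m + ((τ : ℂ) • cubic Y) m = lam * Y m) (hY : Y ≠ 0) :
    lam.im = 0 := by
  have hself : conjCoeff (v + (τ : ℂ) • conv Y (conjCoeff Y)) =
      v + (τ : ℂ) • conv Y (conjCoeff Y) := by
    rw [conjCoeff_add, conjCoeff_smul, conjCoeff_conv, conjCoeff_conjCoeff, hv, conv_comm,
      Complex.conj_ofReal]
  refine im_eq_zero_of_eigenvector (a := a) hself (fun m => ?_) hY
  rw [map_add, map_smul]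
  exact (add_assoc _ _ _).symm.trans (h m)

/-! ### Lyapunov–Schmidt reduction -/

theorem exists_fixedPoint_of_half_lipschitz {X : Type*} [NormedAddCommGroup X] [CompleteSpace X]
    {Φ : X → X} {r : ℝ} (hr : 0 ≤ r) (h0 : ‖Φ 0‖ ≤ r / 2)
    (hL : ∀ x y, ‖x‖ ≤ r → ‖y‖ ≤ r → ‖Φ x - Φ y‖ ≤ 1 / 2 * ‖x - y‖) :
    ∃ x, ‖x‖ ≤ r ∧ ‖x‖ ≤ 2 * ‖Φ 0‖ ∧ Φ x = x := by
  have norm_le (x : X) (hx : ‖x‖ ≤ r) : ‖Φ x‖ ≤ ‖x‖ / 2 + ‖Φ 0‖ := by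
    have := hL x 0 hx (by simpa using hr)
    rw [sub_zero] at this
    linarith [norm_sub_norm_le (Φ x) (Φ 0)]
  have hmaps : Set.MapsTo Φ (Metric.closedBall 0 r) (Metric.closedBall 0 r) := fun x hx => by
    rw [mem_closedBall_zero_iff] at hx ⊢
    linarith [norm_le x hx]
  have hcontr : ContractingWith (1 / 2 : NNReal) (hmaps.restrict Φ _ _) := by
    refine ⟨by norm_num, LipschitzWith.of_dist_le_mul fun x y => ?_⟩
    have := hL x y (mem_closedBall_zero_iff.1 x.2) (mem_closedBall_zero_iff.1 y.2)
    simpa [Subtype.dist_eq, dist_eq_norm] using this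
  obtain ⟨x, hx, hfix, -⟩ := hcontr.exists_fixedPoint' Metric.isClosed_closedBall.isComplete hmaps
    (x := (0 : X)) (by simpa using hr) (edist_ne_top _ _)
  rw [mem_closedBall_zero_iff] at hx
  have := norm_le x hx
  rw [hfix.eq] at this
  exact ⟨x, hx, by linarith, hfix⟩

section Reduction

variable {X : Type*} [NormedAddCommGroup X] [NormedSpace ℂ X]
  {W U Rb Rc : X →L[ℂ] X} {φ : X →L[ℂ] ℂ} {K : X → X} {e : X} {ω C g η r : ℝ}

/-- The eigenvalue correction `μ(z)` enforced by the solvability condition in the direction of the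
unperturbed eigenvector. -/
def eigenvalueShift (U : X →L[ℂ] X) (φ : X →L[ℂ] ℂ) (K : X → X) (z : X) : ℂ :=
  φ (U z + K z)

/-- The forcing term `μ(z) z - K(z)` of the equation for the correction `z`. -/
def forcing (U : X →L[ℂ] X) (φ : X →L[ℂ] ℂ) (K : X → X) (z : X) : X :=
  eigenvalueShift U φ K z • z - K z

/-- The component outside the block of the correction, computed from a first approximation `z`. -/
def complementPart (W U Rc : X →L[ℂ] X) (φ : X →L[ℂ] ℂ) (K : X → X) (e z : X) : X :=
  Rc (forcing U φ K z - W (e + z))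

/-- The reduced equation `z = Φ(z)`: the coupling `W` enters the block only through the component
outside of it, which is what makes `Φ` a contraction although `Rb W` is not small. -/
def reductionMap (W U Rb Rc : X →L[ℂ] X) (φ : X →L[ℂ] ℂ) (K : X → X) (e z : X) : X :=
  complementPart W U Rc φ K e z + Rb (forcing U φ K z - W (complementPart W U Rc φ K e z))

theorem norm_eigenvalueShift_sub_le (hU : ‖U‖ ≤ ω) (hφ : ‖φ‖ ≤ 1)
    {x y : X} (hK : ‖K x - K y‖ ≤ η * ‖x - y‖) :
    ‖eigenvalueShift U φ K x - eigenvalueShift U φ K y‖ ≤ (ω + η) * ‖x - y‖ :=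
  calc ‖eigenvalueShift U φ K x - eigenvalueShift U φ K y‖
    _ = ‖φ (U (x - y) + (K x - K y))‖ := by
        simp only [eigenvalueShift, ← map_sub]; congr 2; rw [map_sub]; abel
    _ ≤ ‖U (x - y)‖ + ‖K x - K y‖ :=
        (φ.le_of_opNorm_le hφ _).trans ((one_mul _).trans_le (norm_add_le _ _))
    _ ≤ (ω + η) * ‖x - y‖ := by
        rw [add_mul]; exact add_le_add (U.le_of_opNorm_le hU _) hK

theorem norm_eigenvalueShift_le (hU : ‖U‖ ≤ ω) (hφ : ‖φ‖ ≤ 1) {z : X}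
    (hK : ‖K z - K 0‖ ≤ η * ‖z - 0‖) (hK0 : ‖K 0‖ ≤ η) :
    ‖eigenvalueShift U φ K z‖ ≤ (ω + η) * ‖z‖ + η := by
  have h0 : ‖eigenvalueShift U φ K 0‖ ≤ η := by
    simpa [eigenvalueShift] using (φ.le_of_opNorm_le hφ (K 0)).trans ((one_mul _).trans_le hK0)
  have := norm_eigenvalueShift_sub_le hU hφ hK
  rw [sub_zero] at this
  linarith [norm_sub_norm_le (eigenvalueShift U φ K z) (eigenvalueShift U φ K 0)]

theorem norm_forcing_sub_le (hU : ‖U‖ ≤ ω) (hφ : ‖φ‖ ≤ 1) (hK0 : ‖K 0‖ ≤ η)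
    (hK : ∀ x y, ‖x‖ ≤ r → ‖y‖ ≤ r → ‖K x - K y‖ ≤ η * ‖x - y‖) {x y : X}
    (hx : ‖x‖ ≤ r) (hy : ‖y‖ ≤ r) :
    ‖forcing U φ K x - forcing U φ K y‖ ≤ (2 * (ω + η) * r + 2 * η) * ‖x - y‖ := by
  have hr : 0 ≤ r := (norm_nonneg x).trans hx
  have hη : 0 ≤ η := (norm_nonneg _).trans hK0
  have hω : 0 ≤ ω := (norm_nonneg _).trans hU
  have split : forcing U φ K x - forcing U φ K y =
      eigenvalueShift U φ K x • (x - y) +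
        (eigenvalueShift U φ K x - eigenvalueShift U φ K y) • y - (K x - K y) := by
    simp only [forcing, smul_sub, sub_smul]; abel
  have hx' : ‖eigenvalueShift U φ K x • (x - y)‖ ≤ ((ω + η) * r + η) * ‖x - y‖ := by
    rw [norm_smul]
    gcongr
    refine (norm_eigenvalueShift_le hU hφ (hK x 0 hx (by simpa)) hK0).trans ?_
    gcongr
  have hy' : ‖(eigenvalueShift U φ K x - eigenvalueShift U φ K y) • y‖ ≤
      (ω + η) * ‖x - y‖ * r := by
    rw [norm_smul]
    gcongr
    exact norm_eigenvalueShift_sub_le hU hφ (hK x y hx hy)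
  rw [split]
  refine (norm_sub_le _ _).trans ?_
  linarith [norm_add_le (eigenvalueShift U φ K x • (x - y))
    ((eigenvalueShift U φ K x - eigenvalueShift U φ K y) • y), hK x y hx hy]

theorem norm_complementPart_sub_le (hW : ‖W‖ ≤ ω) (hRc : ‖Rc‖ ≤ g) {L : ℝ} {x y : X}
    (hB : ‖forcing U φ K x - forcing U φ K y‖ ≤ L * ‖x - y‖) :
    ‖complementPart W U Rc φ K e x - complementPart W U Rc φ K e y‖ ≤
      g * (L + ω) * ‖x - y‖ :=
  calc ‖complementPart W U Rc φ K e x - complementPart W U Rc φ K e y‖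
    _ = ‖Rc (forcing U φ K x - forcing U φ K y - W (x - y))‖ := by
        simp only [complementPart, ← map_sub]; congr 2; simp only [map_sub, map_add]; abel
    _ ≤ g * ‖forcing U φ K x - forcing U φ K y - W (x - y)‖ := Rc.le_of_opNorm_le hRc _
    _ ≤ g * (L * ‖x - y‖ + ω * ‖x - y‖) := by
        have := (norm_nonneg _).trans hRc
        gcongr
        exact (norm_sub_le _ _).trans (add_le_add hB (W.le_of_opNorm_le hW _))
    _ = g * (L + ω) * ‖x - y‖ := by ring

theorem norm_reductionMap_sub_le (hW : ‖W‖ ≤ ω) (hRb : ‖Rb‖ ≤ C) (hRc : ‖Rc‖ ≤ g) {L : ℝ}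
    {x y : X} (hB : ‖forcing U φ K x - forcing U φ K y‖ ≤ L * ‖x - y‖) :
    ‖reductionMap W U Rb Rc φ K e x - reductionMap W U Rb Rc φ K e y‖ ≤
      (g * (L + ω) * (1 + C * ω) + C * L) * ‖x - y‖ := by
  have hC : 0 ≤ C := (norm_nonneg _).trans hRb
  have hω : 0 ≤ ω := (norm_nonneg _).trans hW
  have hs := norm_complementPart_sub_le (e := e) hW hRc hB
  have hrest : ‖Rb (forcing U φ K x - forcing U φ K y -
      W (complementPart W U Rc φ K e x - complementPart W U Rc φ K e y))‖ ≤
        C * (L * ‖x - y‖ + ω * (g * (L + ω) * ‖x - y‖)) := by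
    refine (Rb.le_of_opNorm_le hRb _).trans (mul_le_mul_of_nonneg_left ?_ hC)
    exact (norm_sub_le _ _).trans (add_le_add hB
      ((W.le_of_opNorm_le hW _).trans (mul_le_mul_of_nonneg_left hs hω)))
  have split : reductionMap W U Rb Rc φ K e x - reductionMap W U Rb Rc φ K e y =
      (complementPart W U Rc φ K e x - complementPart W U Rc φ K e y) +
        Rb (forcing U φ K x - forcing U φ K y -
          W (complementPart W U Rc φ K e x - complementPart W U Rc φ K e y)) := by
    simp only [reductionMap, map_sub]; abel
  rw [split]
  refine (norm_add_le_of_le hs hrest).trans_eq (by ring)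

theorem norm_reductionMap_sub_le_half (hω : 1 ≤ ω) (hW : ‖W‖ ≤ ω) (hU : ‖U‖ ≤ ω) (hC : 1 ≤ C)
    (hRb : ‖Rb‖ ≤ C) (hRc : ‖Rc‖ ≤ g) (hφ : ‖φ‖ ≤ 1) (hK0 : ‖K 0‖ ≤ η)
    (hK : ∀ x y, ‖x‖ ≤ r → ‖y‖ ≤ r → ‖K x - K y‖ ≤ η * ‖x - y‖) (hr : 16 * (C * ω * r) ≤ 1)
    (hg : 384 * (C * ω ^ 2 * g) ≤ 1) (hη : 64 * (C * η) ≤ 1) {x y : X} (hx : ‖x‖ ≤ r)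
    (hy : ‖y‖ ≤ r) :
    ‖reductionMap W U Rb Rc φ K e x - reductionMap W U Rb Rc φ K e y‖ ≤ 1 / 2 * ‖x - y‖ := by
  have hg0 : 0 ≤ g := (norm_nonneg _).trans hRc
  have hη0 : 0 ≤ η := (norm_nonneg _).trans hK0
  have hr0 : 0 ≤ r := (norm_nonneg _).trans hx
  have hCω : 1 ≤ C * ω := by nlinarith
  have hr1 : r ≤ 1 := by nlinarith
  refine (norm_reductionMap_sub_le hW hRb hRc (norm_forcing_sub_le hU hφ hK0 hK hx hy)).trans ?_
  gcongr
  set L := 2 * (ω + η) * r + 2 * η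
  have hL0 : 0 ≤ L := by positivity
  have hCL : C * L ≤ 1 / 4 := by
    have : C * η * r ≤ C * η := mul_le_of_le_one_right (by positivity) hr1
    linear_combination hr / 8 + 2 * this + hη / 16
  have hLω : L ≤ ω := by nlinarith
  calc g * (L + ω) * (1 + C * ω) + C * L
    _ ≤ g * (ω + ω) * (C * ω + C * ω) + 1 / 4 := by gcongr
    _ ≤ 1 / 2 := by linear_combination hg / 96

theorem norm_reductionMap_zero_le (hω : 1 ≤ ω) (hW : ‖W‖ ≤ ω) (hC : 1 ≤ C) (hRb : ‖Rb‖ ≤ C)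
    (hRc : ‖Rc‖ ≤ g) (he : ‖e‖ ≤ 2) (hK0 : ‖K 0‖ ≤ η) (hη : η ≤ 1) :
    ‖reductionMap W U Rb Rc φ K e 0‖ ≤ 6 * C * ω ^ 2 * g + C * η := by
  have hg : 0 ≤ g := (norm_nonneg _).trans hRc
  have hB : ‖forcing U φ K 0‖ ≤ η := by simpa [forcing] using hK0
  have hs : ‖complementPart W U Rc φ K e 0‖ ≤ g * (3 * ω) := by
    refine (Rc.le_of_opNorm_le hRc _).trans (mul_le_mul_of_nonneg_left ?_ hg)
    have : ‖W (e + 0)‖ ≤ ω * 2 := by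
      rw [add_zero]; exact (W.le_of_opNorm_le hW e).trans (by gcongr)
    linarith [norm_sub_le (forcing U φ K 0) (W (e + 0))]
  have hrest : ‖Rb (forcing U φ K 0 - W (complementPart W U Rc φ K e 0))‖ ≤
      C * (η + ω * (g * (3 * ω))) := by
    refine (Rb.le_of_opNorm_le hRb _).trans (mul_le_mul_of_nonneg_left ?_ (by linarith))
    exact (norm_sub_le _ _).trans (add_le_add hB
      ((W.le_of_opNorm_le hW _).trans (mul_le_mul_of_nonneg_left hs (by linarith))))
  have hCω : ω ≤ C * ω ^ 2 := by nlinarith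
  refine (norm_add_le_of_le hs hrest).trans ?_
  nlinarith [mul_le_mul_of_nonneg_left hCω hg]

theorem exists_fixedPoint_reductionMap [CompleteSpace X] (hω : 1 ≤ ω) (hW : ‖W‖ ≤ ω)
    (hU : ‖U‖ ≤ ω) (hC : 1 ≤ C) (hRb : ‖Rb‖ ≤ C) (hRc : ‖Rc‖ ≤ g) (hφ : ‖φ‖ ≤ 1) (he : ‖e‖ ≤ 2)
    (hK0 : ‖K 0‖ ≤ η) (hK : ∀ x y, ‖x‖ ≤ 1 → ‖y‖ ≤ 1 → ‖K x - K y‖ ≤ η * ‖x - y‖)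
    (hg : 384 * (C ^ 2 * ω ^ 3 * g) ≤ 1) (hη : 64 * (C ^ 2 * ω * η) ≤ 1) :
    ∃ z, ‖z‖ ≤ 1 ∧ ‖z‖ ≤ 12 * C * ω ^ 2 * g + 2 * C * η ∧ reductionMap W U Rb Rc φ K e z = z := by
  have hg0 : 0 ≤ g := (norm_nonneg _).trans hRc
  have hη0 : 0 ≤ η := (norm_nonneg _).trans hK0
  set r := 1 / (16 * C * ω) with hr
  have hr0 : 0 < r := by positivity
  have hCω : 1 ≤ C * ω := by nlinarith
  have hCωr : C * ω * r = 1 / 16 := by rw [hr]; field_simp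
  have hr1 : r ≤ 1 := by nlinarith
  have hCωη : 64 * (C * ω * η) ≤ 1 := by
    refine le_trans ?_ hη
    gcongr
    exact le_self_pow₀ hC two_ne_zero
  have hCη : 64 * (C * η) ≤ 1 := by nlinarith [mul_nonneg (by linarith : 0 ≤ C) hη0]
  have hCωg : 384 * (C * ω ^ 2 * g) ≤ 1 := by
    refine le_trans ?_ hg
    gcongr
    · exact le_self_pow₀ hC two_ne_zero
    · norm_num
  have hzero : ‖reductionMap W U Rb Rc φ K e 0‖ ≤ 6 * C * ω ^ 2 * g + C * η :=
    norm_reductionMap_zero_le hω hW hC hRb hRc he hK0 (by nlinarith)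
  have hhalf : 6 * C * ω ^ 2 * g + C * η ≤ r / 2 := by
    rw [hr, div_div, le_div_iff₀ (by positivity)]
    linear_combination hg / 2 + hη / 2
  obtain ⟨z, hzr, hz, hfix⟩ :=
    exists_fixedPoint_of_half_lipschitz hr0.le (hzero.trans hhalf) fun x y hx hy =>
      norm_reductionMap_sub_le_half hω hW hU hC hRb hRc hφ hK0
        (fun x y hx hy => hK x y (hx.trans hr1) (hy.trans hr1)) (by rw [hCωr]; norm_num)
        hCωg hCη hx hy
  exact ⟨z, hzr.trans hr1, by linarith, hfix⟩

theorem exists_reduced_solution [CompleteSpace X] (hω : 1 ≤ ω) (hW : ‖W‖ ≤ ω) (hU : ‖U‖ ≤ ω)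
    (hC : 1 ≤ C) (hRb : ‖Rb‖ ≤ C) (hRc : ‖Rc‖ ≤ g) (hφ : ‖φ‖ ≤ 1) (he : ‖e‖ ≤ 2)
    (hK0 : ‖K 0‖ ≤ η) (hK : ∀ x y, ‖x‖ ≤ 1 → ‖y‖ ≤ 1 → ‖K x - K y‖ ≤ η * ‖x - y‖)
    (hg : 384 * (C ^ 2 * ω ^ 3 * g) ≤ 1) (hη : 64 * (C ^ 2 * ω * η) ≤ 1) :
    ∃ (z y : X) (μ : ℂ), μ = φ (U z + K z) ∧ y = Rc (μ • z - K z - W (e + z)) ∧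
      z = y + Rb (μ • z - K z - W y) ∧
      ‖z‖ ≤ 12 * C * ω ^ 3 * (g + η) ∧ ‖μ‖ ≤ 12 * C * ω ^ 3 * (g + η) := by
  have hη0 : 0 ≤ η := (norm_nonneg _).trans hK0
  have hCω : 1 ≤ C * ω := by nlinarith
  obtain ⟨z, hz1, hz, hfix⟩ :=
    exists_fixedPoint_reductionMap hω hW hU hC hRb hRc hφ he hK0 hK hg hη
  have hμ := norm_eigenvalueShift_le hU hφ (hK z 0 hz1 (by simp)) hK0
  have hbound : ω * ‖z‖ + 2 * η ≤ 12 * C * ω ^ 3 * (g + η) :=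
    calc ω * ‖z‖ + 2 * η
      _ ≤ ω * (12 * C * ω ^ 2 * g + 2 * C * η) + 2 * (C * ω) * η := by gcongr; linarith
      _ = 12 * C * ω ^ 3 * g + 4 * C * ω * η := by ring
      _ ≤ 12 * C * ω ^ 3 * g + 12 * C * ω ^ 3 * η := by
        gcongr
        · norm_num
        · exact le_self_pow₀ hω three_ne_zero
      _ = 12 * C * ω ^ 3 * (g + η) := by ring
  refine ⟨z, complementPart W U Rc φ K e z, eigenvalueShift U φ K z, rfl, rfl, hfix.symm, ?_, ?_⟩
  · nlinarith [norm_nonneg z]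
  · nlinarith [mul_le_mul_of_nonneg_left hz1 hη0]

end Reduction

/-! ### Nonlinear eigenvectors close to an eigenvector of a two-point block -/

/-- `(e₀, e₁)` is a unit eigenvector, with eigenvalue `Λ`, of the Hermitian matrix
`!![α, b; conj b, β]`. -/
structure IsUnitEigenvector (α β : ℝ) (b : ℂ) (Λ : ℝ) (e₀ e₁ : ℂ) : Prop where
  fst : α * e₀ + b * e₁ = Λ * e₀
  snd : conj b * e₀ + β * e₁ = Λ * e₁
  norm_sq : ‖e₀‖ ^ 2 + ‖e₁‖ ^ 2 = 1

namespace IsUnitEigenvector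

variable {α β Λ : ℝ} {b e₀ e₁ : ℂ}

theorem norm_fst_le (h : IsUnitEigenvector α β b Λ e₀ e₁) : ‖e₀‖ ≤ 1 := by
  nlinarith [h.norm_sq, norm_nonneg e₀, sq_nonneg ‖e₁‖]

theorem norm_snd_le (h : IsUnitEigenvector α β b Λ e₀ e₁) : ‖e₁‖ ≤ 1 := by
  nlinarith [h.norm_sq, norm_nonneg e₁, sq_nonneg ‖e₀‖]

theorem conj_mul_self_add (h : IsUnitEigenvector α β b Λ e₀ e₁) :
    conj e₀ * e₀ + conj e₁ * e₁ = 1 := by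
  rw [Complex.conj_mul', Complex.conj_mul']
  exact_mod_cast h.norm_sq

/-- `(-conj e₁, conj e₀)` is an eigenvector for the other eigenvalue `α + β - Λ`; in the
orthonormal basis it forms with `(e₀, e₁)`, the perturbed equation splits into the first-order
relations `hμ` and `hc`. -/
theorem perturbed_eq (h : IsUnitEigenvector α β b Λ e₀ e₁) {μ c p₀ p₁ : ℂ}
    (hμ : μ = conj e₀ * p₀ + conj e₁ * p₁)
    (hc : -((2 * Λ - α - β : ℝ) * c) = μ * c + e₁ * p₀ - e₀ * p₁) :
    α * (e₀ - c * conj e₁) + b * (e₁ + c * conj e₀) + p₀ = (Λ + μ) * (e₀ - c * conj e₁) ∧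
      conj b * (e₀ - c * conj e₁) + β * (e₁ + c * conj e₀) + p₁ =
        (Λ + μ) * (e₁ + c * conj e₀) := by
  have hfst : α * conj e₀ + conj b * conj e₁ = Λ * conj e₀ := by
    simpa using congrArg conj h.fst
  have hsnd : b * conj e₀ + β * conj e₁ = Λ * conj e₁ := by
    simpa using congrArg conj h.snd
  push_cast at hc
  subst hμ
  constructor
  · linear_combination h.fst + c * hsnd - conj e₁ * hc - p₀ * h.conj_mul_self_add
  · linear_combination h.snd - c * hfst + conj e₀ * hc - p₁ * h.conj_mul_self_add

end IsUnitEigenvector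

section Block

variable {ι : Type*} {s p : ι}

/-- The functional `Y ↦ x Yₛ + y Yₚ`. -/
def pairFunctional (s p : ι) (x y : ℂ) : ℓ¹(ι, ℂ) →L[ℂ] ℂ :=
  x • lp.evalCLM ℂ (fun _ => ℂ) 1 s + y • lp.evalCLM ℂ (fun _ => ℂ) 1 p

theorem pairFunctional_apply (x y : ℂ) (Y : ℓ¹(ι, ℂ)) :
    pairFunctional s p x y Y = x * Y s + y * Y p := rfl

theorem norm_pairFunctional_le (hsp : s ≠ p) {x y : ℂ} (hx : ‖x‖ ≤ 1) (hy : ‖y‖ ≤ 1) :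
    ‖pairFunctional s p x y‖ ≤ 1 := by
  refine ContinuousLinearMap.opNorm_le_bound _ zero_le_one fun Y => ?_
  calc ‖x * Y s + y * Y p‖
    _ ≤ ‖x‖ * ‖Y s‖ + ‖y‖ * ‖Y p‖ := by simpa using norm_add_le (x * Y s) (y * Y p)
    _ ≤ ‖Y s‖ + ‖Y p‖ := by
      gcongr <;> exact mul_le_of_le_one_left (norm_nonneg _) ‹_›
    _ ≤ 1 * ‖Y‖ := by simpa using norm_apply_add_norm_apply_le Y hsp

variable [DecidableEq ι] {Λ d C : ℝ} {e₀ e₁ : ℂ}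

/-- The vector with entries `x` at `s` and `y` at `p`. -/
def pairVector (s p : ι) (x y : ℂ) : ℓ¹(ι, ℂ) :=
  lp.single 1 s x + lp.single 1 p y

theorem pairVector_apply_fst (hsp : s ≠ p) (x y : ℂ) : pairVector s p x y s = x := by
  simp [pairVector, hsp]

theorem pairVector_apply_snd (hsp : s ≠ p) (x y : ℂ) : pairVector s p x y p = y := by
  simp [pairVector, hsp.symm]

theorem pairVector_apply_of_ne {m : ι} (hs : m ≠ s) (hp : m ≠ p) (x y : ℂ) :
    pairVector s p x y m = 0 := by
  simp [pairVector, hs, hp]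

theorem norm_pairVector_le (x y : ℂ) : ‖pairVector s p x y‖ ≤ ‖x‖ + ‖y‖ := by
  simpa [pairVector, lp.norm_single one_pos] using
    norm_add_le (lp.single 1 s x : ℓ¹(ι, ℂ)) (lp.single 1 p y)

/-- The inverse of the block at `{s, p}`, shifted by its eigenvalue, on the orthogonal complement
of the unit eigenvector `(e₀, e₁)`; the other eigenvalue of the block lies at distance `d`. -/
def blockResolvent (s p : ι) (e₀ e₁ : ℂ) (d : ℝ) : ℓ¹(ι, ℂ) →L[ℂ] ℓ¹(ι, ℂ) :=
  (pairFunctional s p (-e₁) e₀).smulRight (-(d : ℂ)⁻¹ • pairVector s p (-conj e₁) (conj e₀))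

theorem blockResolvent_apply (Y : ℓ¹(ι, ℂ)) :
    blockResolvent s p e₀ e₁ d Y =
      pairFunctional s p (-e₁) e₀ Y • (-(d : ℂ)⁻¹ • pairVector s p (-conj e₁) (conj e₀)) := rfl

theorem norm_blockResolvent_le (hsp : s ≠ p) (he₀ : ‖e₀‖ ≤ 1) (he₁ : ‖e₁‖ ≤ 1) (hd : 0 < d)
    (hC : 2 ≤ C * d) : ‖blockResolvent s p e₀ e₁ d‖ ≤ C := by
  have hvec : ‖pairVector s p (-conj e₁) (conj e₀)‖ ≤ 2 := by
    refine (norm_pairVector_le _ _).trans ?_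
    simp only [norm_neg, RCLike.norm_conj]
    linarith
  rw [blockResolvent, ContinuousLinearMap.norm_smulRight_apply, norm_smul, norm_neg, norm_inv,
    Complex.norm_of_nonneg hd.le]
  have hfun := norm_pairFunctional_le hsp (x := -e₁) (by simpa using he₁) he₀
  have hle : d⁻¹ * ‖pairVector s p (-conj e₁) (conj e₀)‖ ≤ C := by
    rw [inv_mul_le_iff₀ hd]; linarith
  exact (mul_le_of_le_one_left (by positivity) hfun).trans hle

/-- The coordinate projection annihilating the coordinates `s` and `p`. -/
def offBlock (s p : ι) : ℓ¹(ι, ℂ) →L[ℂ] ℓ¹(ι, ℂ) :=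
  diagonal (fun m => if m = s ∨ m = p then 0 else 1) zero_le_one fun m => by
    split_ifs <;> simp

theorem norm_offBlock_le : ‖offBlock s p‖ ≤ 1 := norm_diagonal_le _ _

theorem pairVector_add_offBlock (hsp : s ≠ p) (Y : ℓ¹(ι, ℂ)) :
    pairVector s p (Y s) (Y p) + offBlock s p Y = Y := by
  ext m
  rw [lp.coeFn_add, Pi.add_apply, offBlock, diagonal_apply]
  by_cases hs : m = s
  · simp [hs, pairVector_apply_fst hsp]
  by_cases hp : m = p
  · simp [hp, pairVector_apply_snd hsp]
  · simp [hs, hp, pairVector_apply_of_ne hs hp]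

theorem offBlock_eq {Y Z : ℓ¹(ι, ℂ)} (hs : Z s = 0) (hp : Z p = 0)
    (h : ∀ m, m ≠ s → m ≠ p → Y m = Z m) : offBlock s p Y = Z := by
  ext m
  rw [offBlock, diagonal_apply]
  split_ifs with hm
  · rcases hm with rfl | rfl <;> simp [*]
  · rw [not_or] at hm
    rw [one_mul, h m hm.1 hm.2]

/-- The inverse of `diag (a - Λ)` away from the coordinates `s` and `p`. -/
def offBlockResolvent {a : ι → ℝ} {g : ℝ} (hg : 0 ≤ g)
    (hfar : ∀ m, m ≠ s → m ≠ p → 1 ≤ g * |a m - Λ|) : ℓ¹(ι, ℂ) →L[ℂ] ℓ¹(ι, ℂ) :=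
  diagonal (fun m => if m = s ∨ m = p then 0 else ((a m - Λ : ℝ) : ℂ)⁻¹) hg fun m => by
    split_ifs with h
    · simpa using hg
    · rw [not_or] at h
      have hm := hfar m h.1 h.2
      rw [norm_inv, Complex.norm_real, Real.norm_eq_abs, inv_le_iff_one_le_mul₀]
      · exact hm
      · by_contra! hle
        nlinarith

variable {a : ι → ℝ} {g : ℝ} {hg : 0 ≤ g} {hfar : ∀ m, m ≠ s → m ≠ p → 1 ≤ g * |a m - Λ|}

theorem norm_offBlockResolvent_le : ‖offBlockResolvent hg hfar‖ ≤ g := norm_diagonal_le _ _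

theorem offBlockResolvent_apply_fst (F : ℓ¹(ι, ℂ)) : offBlockResolvent hg hfar F s = 0 := by
  simp [offBlockResolvent]

theorem offBlockResolvent_apply_snd (F : ℓ¹(ι, ℂ)) : offBlockResolvent hg hfar F p = 0 := by
  simp [offBlockResolvent]

theorem sub_mul_offBlockResolvent_apply {m : ι} (hs : m ≠ s) (hp : m ≠ p) (F : ℓ¹(ι, ℂ)) :
    (a m - Λ) * offBlockResolvent hg hfar F m = F m := by
  have hne : (a m - Λ : ℂ) ≠ 0 := fun h0 => by
    have h0' : a m - Λ = 0 := by exact_mod_cast h0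
    have := hfar m hs hp
    norm_num [h0'] at this
  simp [offBlockResolvent, hs, hp, mul_inv_cancel_left₀ hne]

section Group

variable [AddCommGroup ι] {v N z y : ℓ¹(ι, ℂ)} {μ : ℂ}

theorem conv_apply_eq_add_offBlock (hsp : s ≠ p) (v Y : ℓ¹(ι, ℂ)) (m : ι) :
    conv v Y m = v (m - s) * Y s + v (m - p) * Y p + conv v (offBlock s p Y) m := by
  conv_lhs => rw [← pairVector_add_offBlock hsp Y]
  simp only [pairVector, map_add, lp.coeFn_add, Pi.add_apply, conv_single_apply]

theorem eigenvector_of_block_coordinates (hsp : s ≠ p) {Y : ℓ¹(ι, ℂ)} {c : ℂ} (hv0 : v 0 = 0)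
    (hvr : conjCoeff v = v) (he : IsUnitEigenvector (a s) (a p) (v (s - p)) Λ e₀ e₁)
    (hs : Y s = e₀ - c * conj e₁) (hp : Y p = e₁ + c * conj e₀)
    (hμ : μ = conj e₀ * (conv v (offBlock s p Y) + N) s + conj e₁ * (conv v (offBlock s p Y) + N) p)
    (hc : -((2 * Λ - a s - a p : ℝ) * c) = μ * c + e₁ * (conv v (offBlock s p Y) + N) s -
      e₀ * (conv v (offBlock s p Y) + N) p)
    (hoff : ∀ m, m ≠ s → m ≠ p → (a m - Λ) * Y m = μ * Y m - N m - conv v Y m) :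
    (∀ m, a m * Y m + conv v Y m + N m = (Λ + μ) * Y m) ∧ Y ≠ 0 := by
  have hvps : v (p - s) = conj (v (s - p)) := by
    simpa [hvr] using conjCoeff_apply v (p - s)
  obtain ⟨hfst, hsnd⟩ := he.perturbed_eq hμ hc
  rw [lp.coeFn_add, Pi.add_apply, ← hs, ← hp] at hfst hsnd
  constructor
  · intro m
    by_cases hms : m = s
    · subst hms
      rw [conv_apply_eq_add_offBlock hsp, sub_self, hv0]
      linear_combination hfst
    by_cases hmp : m = p
    · subst hmp
      rw [conv_apply_eq_add_offBlock hsp, sub_self, hv0, hvps]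
      linear_combination hsnd
    · linear_combination hoff m hms hmp
  · rintro rfl
    have hs' : 0 = e₀ - c * conj e₁ := hs
    have hp' : 0 = e₁ + c * conj e₀ := hp
    exact zero_ne_one
      (by linear_combination conj e₀ * hs' + conj e₁ * hp' + he.conj_mul_self_add : (0 : ℂ) = 1)

theorem eigenvector_of_reduced_solution (hsp : s ≠ p) (hv0 : v 0 = 0) (hvr : conjCoeff v = v)
    (he : IsUnitEigenvector (a s) (a p) (v (s - p)) Λ e₀ e₁) (hd : 0 < 2 * Λ - a s - a p)
    (hμ : μ = pairFunctional s p (conj e₀) (conj e₁) (conv v (offBlock s p z) + N))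
    (hy : y = offBlockResolvent hg hfar (μ • z - N - conv v (pairVector s p e₀ e₁ + z)))
    (hz : z = y + blockResolvent s p e₀ e₁ (2 * Λ - a s - a p) (μ • z - N - conv v y)) :
    (∀ m, a m * (pairVector s p e₀ e₁ + z) m + conv v (pairVector s p e₀ e₁ + z) m + N m =
        (Λ + μ) * (pairVector s p e₀ e₁ + z) m) ∧
      pairVector s p e₀ e₁ + z ≠ 0 := by
  set d := 2 * Λ - a s - a p
  set c := -(d : ℂ)⁻¹ * pairFunctional s p (-e₁) e₀ (μ • z - N - conv v y) with hc
  have hys : y s = 0 := by rw [hy, offBlockResolvent_apply_fst]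
  have hyp : y p = 0 := by rw [hy, offBlockResolvent_apply_snd]
  have hz_apply (m : ι) : z m = y m + c * pairVector s p (-conj e₁) (conj e₀) m := by
    conv_lhs => rw [hz, blockResolvent_apply, smul_smul, mul_comm, ← hc]
    rfl
  have hzs : z s = -(c * conj e₁) := by rw [hz_apply, hys, pairVector_apply_fst hsp]; ring
  have hzp : z p = c * conj e₀ := by rw [hz_apply, hyp, pairVector_apply_snd hsp]; ring
  have hoff {m : ι} (hs : m ≠ s) (hp : m ≠ p) : (pairVector s p e₀ e₁ + z) m = y m := by
    simp [hz_apply m, pairVector_apply_of_ne hs hp]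
  have hyz : offBlock s p z = y := offBlock_eq hys hyp fun m hs hp => by
    simp [hz_apply m, pairVector_apply_of_ne hs hp]
  have hyY : offBlock s p (pairVector s p e₀ e₁ + z) = y := offBlock_eq hys hyp fun m => hoff
  refine eigenvector_of_block_coordinates hsp (c := c) hv0 hvr he ?_ ?_ ?_ ?_ ?_
  · simp [pairVector_apply_fst hsp, hzs, sub_eq_add_neg]
  · simp [pairVector_apply_snd hsp, hzp]
  · rw [hyY, hμ, hyz, pairFunctional_apply]
  · have hdc : -(d * c) = pairFunctional s p (-e₁) e₀ (μ • z - N - conv v y) := by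
      rw [hc]
      field_simp [show (d : ℂ) ≠ 0 by exact_mod_cast hd.ne']
    rw [hyY, hdc, pairFunctional_apply]
    simp only [lp.coeFn_sub, lp.coeFn_smul, lp.coeFn_add, Pi.sub_apply, Pi.smul_apply,
      Pi.add_apply, smul_eq_mul, hzs, hzp]
    linear_combination (μ * c) * he.conj_mul_self_add
  · intro m hs hp
    have hzm : z m = y m := by simp [hz_apply m, pairVector_apply_of_ne hs hp]
    rw [hoff hs hp, ← hzm]
    conv_lhs => rw [hzm, hy, sub_mul_offBlockResolvent_apply hs hp]
    rfl

theorem exists_nonlinear_eigenvector (hsp : s ≠ p) {τ ν : ℝ} (hv0 : v 0 = 0)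
    (hvr : conjCoeff v = v) (he : IsUnitEigenvector (a s) (a p) (v (s - p)) Λ e₀ e₁)
    (hν : 1 ≤ ν) (hvν : ‖v‖ ≤ ν) (hC : 1 ≤ C) (hgap : 2 ≤ C * (2 * Λ - a s - a p))
    (hg : 0 ≤ g) (hfar : ∀ m, m ≠ s → m ≠ p → 1 ≤ g * |a m - Λ|)
    (hgν : 384 * (C ^ 2 * ν ^ 3 * g) ≤ 1) (hτ : 64 * (C ^ 2 * ν * (27 * |τ|)) ≤ 1) :
    ∃ (Y : ℓ¹(ι, ℂ)) (lam : ℝ),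
      (∀ m, a m * Y m + conv v Y m + τ * cubic Y m = lam * Y m) ∧
      ‖Y - pairVector s p e₀ e₁‖ ≤ 12 * C * ν ^ 3 * (g + 27 * |τ|) ∧
      |lam - Λ| ≤ 12 * C * ν ^ 3 * (g + 27 * |τ|) := by
  have hd : 0 < 2 * Λ - a s - a p := by
    by_contra! hle
    nlinarith
  have hV : ‖conv v‖ ≤ ν := (norm_conv_le v).trans hvν
  have hU : ‖(conv v).comp (offBlock s p)‖ ≤ ν :=
    (ContinuousLinearMap.opNorm_comp_le _ _).trans
      ((mul_le_of_le_one_right (norm_nonneg _) norm_offBlock_le).trans hV)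
  have he_norm : ‖pairVector s p e₀ e₁‖ ≤ 2 :=
    (norm_pairVector_le _ _).trans (by linarith [he.norm_fst_le, he.norm_snd_le])
  have hK0 : ‖(τ : ℂ) • cubic (pairVector s p e₀ e₁ + 0)‖ ≤ 27 * |τ| := by
    rw [add_zero, norm_smul, Complex.norm_real, Real.norm_eq_abs]
    nlinarith [norm_cubic_le he_norm, abs_nonneg τ]
  obtain ⟨z, y, μ, hμ, hy, hz, hznorm, hμnorm⟩ := exists_reduced_solution
    (K := fun x => (τ : ℂ) • cubic (pairVector s p e₀ e₁ + x)) hν hV hU hC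
    (norm_blockResolvent_le hsp he.norm_fst_le he.norm_snd_le hd hgap)
    (norm_offBlockResolvent_le (hg := hg) (hfar := hfar))
    (norm_pairFunctional_le hsp (x := conj e₀) (y := conj e₁) (by simpa using he.norm_fst_le)
      (by simpa using he.norm_snd_le))
    he_norm hK0 (fun x y hx hy => norm_smul_cubic_add_sub_le τ he_norm hx hy) hgν hτ
  obtain ⟨heq, hne⟩ := eigenvector_of_reduced_solution hsp hv0 hvr he hd hμ hy hz
  have hreal : μ.im = 0 := by
    simpa using im_eq_zero_of_cubic_eigenvector hvr heq hne
  have hμre : (μ.re : ℂ) = μ := Complex.ext rfl (by simpa using hreal.symm)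
  refine ⟨pairVector s p e₀ e₁ + z, Λ + μ.re, fun m => ?_, by simpa using hznorm, ?_⟩
  · rw [Complex.ofReal_add, hμre]
    exact heq m
  · rw [add_sub_cancel_left]
    exact (Complex.abs_re_le_norm μ).trans hμnorm

end Group

end Block

/-! ### Series of plane waves -/

section PlaneWave

variable {n : ℕ}

theorem norm_planeWave (p x : EuclideanSpace ℝ (Fin n)) : ‖planeWave p x‖ = 1 := by
  rw [planeWave, mul_comm, Complex.norm_exp_ofReal_mul_I]

theorem planeWave_add (p p' x : EuclideanSpace ℝ (Fin n)) :
    planeWave (p + p') x = planeWave p x * planeWave p' x := by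
  rw [planeWave, planeWave, planeWave, ← Complex.exp_add, inner_add_left]
  push_cast
  ring_nf

theorem planeWave_add_right (p x y : EuclideanSpace ℝ (Fin n)) :
    planeWave p (x + y) = planeWave p x * planeWave p y := by
  rw [planeWave, planeWave, planeWave, ← Complex.exp_add, inner_add_right]
  push_cast
  ring_nf

theorem planeWave_zero (x : EuclideanSpace ℝ (Fin n)) : planeWave 0 x = 1 := by
  simp [planeWave]

theorem conj_planeWave (p x : EuclideanSpace ℝ (Fin n)) :
    conj (planeWave p x) = planeWave (-p) x := by
  rw [planeWave, planeWave, ← Complex.exp_conj]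
  simp [inner_neg_left]

theorem latticePoint_add (m p : Fin n → ℤ) :
    latticePoint (m + p) = latticePoint m + latticePoint p := by
  ext i
  simp [latticePoint]

theorem latticePoint_neg (m : Fin n → ℤ) : latticePoint (-m) = -latticePoint m := by
  ext i
  simp [latticePoint]

@[simp]
theorem latticePoint_zero : latticePoint (0 : Fin n → ℤ) = 0 := by
  ext i
  simp [latticePoint]

theorem latticePoint_sub (m p : Fin n → ℤ) :
    latticePoint (m - p) = latticePoint m - latticePoint p := by
  ext i
  simp [latticePoint]

theorem planeWave_single (p : EuclideanSpace ℝ (Fin n)) (s : Fin n) (r : ℝ) :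
    planeWave p (EuclideanSpace.single s r) = Complex.exp (Complex.I * (r * p s : ℝ)) := by
  simp [planeWave, EuclideanSpace.inner_single_right]

theorem planeWave_latticePoint_period (m : Fin n → ℤ) (s : Fin n) :
    planeWave (latticePoint m) (EuclideanSpace.single s (2 * Real.pi)) = 1 := by
  rw [planeWave_single, Complex.exp_eq_one_iff]
  refine ⟨m s, ?_⟩
  simp only [latticePoint]
  push_cast
  ring

theorem iteratedDeriv_exp_I_mul (k : ℕ) :
    iteratedDeriv k (fun s : ℝ => Complex.exp (Complex.I * s)) =
      fun s : ℝ => Complex.I ^ k * Complex.exp (Complex.I * s) := by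
  induction k with
  | zero => simp
  | succ k ih =>
    rw [iteratedDeriv_succ, ih]
    funext s
    have h : HasDerivAt (fun s : ℝ => Complex.exp (Complex.I * s))
        (Complex.exp (Complex.I * s) * (Complex.I * 1)) s :=
      ((Complex.ofRealCLM.hasDerivAt (x := s)).const_mul Complex.I).cexp
    rw [(h.const_mul (Complex.I ^ k)).deriv]
    ring

theorem contDiff_exp_I_mul {N : WithTop ℕ∞} :
    ContDiff ℝ N (fun s : ℝ => Complex.exp (Complex.I * s)) :=
  (contDiff_const.mul Complex.ofRealCLM.contDiff).cexp

theorem contDiff_planeWave {N : WithTop ℕ∞} (p : EuclideanSpace ℝ (Fin n)) :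
    ContDiff ℝ N (planeWave p) :=
  contDiff_exp_I_mul.comp (innerSL ℝ p).contDiff

theorem iteratedFDeriv_planeWave_apply (p x : EuclideanSpace ℝ (Fin n)) (k : ℕ)
    (y : Fin k → EuclideanSpace ℝ (Fin n)) :
    iteratedFDeriv ℝ k (planeWave p) x y =
      (∏ i, ((inner ℝ p (y i) : ℝ) : ℂ)) * (Complex.I ^ k * planeWave p x) := by
  have h : planeWave p = (fun s : ℝ => Complex.exp (Complex.I * s)) ∘ (innerSL ℝ p) := rfl
  rw [h, (innerSL ℝ p).iteratedFDeriv_comp_right (contDiff_exp_I_mul (N := k)) x le_rfl,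
    ContinuousMultilinearMap.compContinuousLinearMap_apply,
    iteratedFDeriv_apply_eq_iteratedDeriv_mul_prod, iteratedDeriv_exp_I_mul]
  simp

theorem norm_iteratedFDeriv_planeWave_le (p x : EuclideanSpace ℝ (Fin n)) (k : ℕ) :
    ‖iteratedFDeriv ℝ k (planeWave p) x‖ ≤ ‖p‖ ^ k := by
  refine ContinuousMultilinearMap.opNorm_le_bound (by positivity) fun y => ?_
  rw [iteratedFDeriv_planeWave_apply]
  simp only [norm_mul, norm_pow, Complex.norm_I, one_pow, norm_planeWave, mul_one, norm_prod,
    Complex.norm_real]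
  calc ∏ i, ‖inner ℝ p (y i)‖ ≤ ∏ i, (‖p‖ * ‖y i‖) :=
        Finset.prod_le_prod (fun _ _ => norm_nonneg _) fun i _ => norm_inner_le_norm _ _
    _ = _ := by rw [Finset.prod_mul_distrib]; simp

end PlaneWave

section WaveSeries

variable {n N : ℕ} {α : Type*} {c : α → ℂ} {p : α → EuclideanSpace ℝ (Fin n)}

/-- The function `x ↦ ∑ₘ cₘ e^{i⟨pₘ, x⟩}`, meaningful for summable `c`. -/
def waveSeries (c : α → ℂ) (p : α → EuclideanSpace ℝ (Fin n)) (x : EuclideanSpace ℝ (Fin n)) : ℂ :=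
  ∑' m, c m * planeWave (p m) x

theorem iteratedFDeriv_const_mul_planeWave (c : ℂ) (p x : EuclideanSpace ℝ (Fin n)) (k : ℕ) :
    iteratedFDeriv ℝ k (fun x => c * planeWave p x) x = c • iteratedFDeriv ℝ k (planeWave p) x :=
  iteratedFDeriv_const_smul_apply' (a := c) (contDiff_planeWave p).contDiffAt

theorem norm_iteratedFDeriv_const_mul_planeWave_le (c : ℂ) (p x : EuclideanSpace ℝ (Fin n))
    (k : ℕ) : ‖iteratedFDeriv ℝ k (fun x => c * planeWave p x) x‖ ≤ ‖c‖ * ‖p‖ ^ k := by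
  rw [iteratedFDeriv_const_mul_planeWave, norm_smul]
  exact mul_le_mul_of_nonneg_left (norm_iteratedFDeriv_planeWave_le p x k) (norm_nonneg _)

theorem pow_le_one_add_pow {r : ℝ} (hr : 0 ≤ r) {k : ℕ} (hk : k ≤ N) : r ^ k ≤ 1 + r ^ N := by
  rcases le_total r 1 with h | h
  · linarith [pow_le_one₀ (n := k) hr h, pow_nonneg hr N]
  · linarith [pow_le_pow_right₀ h hk]

theorem summable_norm_mul_pow_of_le (h0 : Summable fun m => ‖c m‖)
    (hN : Summable fun m => ‖c m‖ * ‖p m‖ ^ N) {k : ℕ} (hk : k ≤ N) :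
    Summable fun m => ‖c m‖ * ‖p m‖ ^ k := by
  refine Summable.of_nonneg_of_le (fun m => by positivity) (fun m => ?_) (h0.add hN)
  rw [← mul_one_add]
  gcongr
  exact pow_le_one_add_pow (norm_nonneg _) hk

theorem contDiff_waveSeries (h0 : Summable fun m => ‖c m‖)
    (hN : Summable fun m => ‖c m‖ * ‖p m‖ ^ N) : ContDiff ℝ N (waveSeries c p) :=
  contDiff_tsum (N := (N : ℕ∞)) (v := fun k m => ‖c m‖ * ‖p m‖ ^ k)
    (fun m => contDiff_const.mul (contDiff_planeWave (p m)))
    (fun _ hk => summable_norm_mul_pow_of_le h0 hN (by exact_mod_cast hk))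
    (fun k m x _ => norm_iteratedFDeriv_const_mul_planeWave_le (c m) (p m) x k)

theorem hasSum_iteratedFDeriv_waveSeries (h0 : Summable fun m => ‖c m‖)
    (hN : Summable fun m => ‖c m‖ * ‖p m‖ ^ N) (x : EuclideanSpace ℝ (Fin n))
    (y : Fin N → EuclideanSpace ℝ (Fin n)) :
    HasSum (fun m => c m * ((∏ i, ((inner ℝ (p m) (y i) : ℝ) : ℂ)) *
      (Complex.I ^ N * planeWave (p m) x))) (iteratedFDeriv ℝ N (waveSeries c p) x y) := by
  have htsum : iteratedFDeriv ℝ N (waveSeries c p) x =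
      ∑' m, iteratedFDeriv ℝ N (fun x => c m * planeWave (p m) x) x :=
    iteratedFDeriv_tsum_apply (N := (N : ℕ∞)) (v := fun k m => ‖c m‖ * ‖p m‖ ^ k)
      (fun m => contDiff_const.mul (contDiff_planeWave (p m)))
      (fun k hk => summable_norm_mul_pow_of_le h0 hN (by exact_mod_cast hk))
      (fun k m x _ => norm_iteratedFDeriv_const_mul_planeWave_le (c m) (p m) x k) le_rfl x
  have hsummable : Summable fun m => iteratedFDeriv ℝ N (fun x => c m * planeWave (p m) x) x :=
    Summable.of_norm_bounded hN fun m =>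
      norm_iteratedFDeriv_const_mul_planeWave_le (c m) (p m) x N
  rw [htsum]
  simpa only [iteratedFDeriv_const_mul_planeWave, ContinuousMultilinearMap.apply_apply,
    smul_apply, iteratedFDeriv_planeWave_apply, smul_eq_mul] using
    hsummable.hasSum.mapL (ContinuousMultilinearMap.apply ℝ _ _ y)

theorem neg_laplacian_waveSeries (h0 : Summable fun m => ‖c m‖)
    (h2 : Summable fun m => ‖c m‖ * ‖p m‖ ^ 2) :
    -Laplacian.laplacian (waveSeries c p) = waveSeries (fun m => c m * (‖p m‖ ^ 2 : ℝ)) p := by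
  funext x
  have hnorm (m : α) : ((‖p m‖ ^ 2 : ℝ) : ℂ) = ∑ i, (p m i : ℂ) ^ 2 := by
    rw [EuclideanSpace.real_norm_sq_eq]
    push_cast
    rfl
  have hsum := (hasSum_sum (s := Finset.univ) fun i _ =>
    hasSum_iteratedFDeriv_waveSeries h0 h2 x
      ![EuclideanSpace.basisFun (Fin n) ℝ i, EuclideanSpace.basisFun (Fin n) ℝ i]).neg
  rw [Pi.neg_apply, InnerProductSpace.laplacian_eq_iteratedFDeriv_orthonormalBasis _
    (EuclideanSpace.basisFun (Fin n) ℝ), ← hsum.tsum_eq]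
  refine tsum_congr fun m => ?_
  beta_reduce
  rw [hnorm, Finset.mul_sum, Finset.sum_mul, ← Finset.sum_neg_distrib]
  refine Finset.sum_congr rfl fun i _ => ?_
  simp [Fin.prod_univ_two, EuclideanSpace.inner_single_right]
  ring

theorem polyLaplacian_waveSeries (l : ℕ) (h0 : Summable fun m => ‖c m‖)
    (hl : Summable fun m => ‖c m‖ * ‖p m‖ ^ (2 * l)) :
    polyLaplacian l (waveSeries c p) = waveSeries (fun m => c m * (‖p m‖ ^ (2 * l) : ℝ)) p := by
  induction l with
  | zero => simp [polyLaplacian]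
  | succ l ih =>
    have hle {k : ℕ} (hk : k ≤ 2 * (l + 1)) := summable_norm_mul_pow_of_le h0 hl hk
    have ih := ih (hle (by omega))
    rw [polyLaplacian] at ih ⊢
    have hnorm (m : α) : ‖c m * (‖p m‖ ^ (2 * l) : ℝ)‖ = ‖c m‖ * ‖p m‖ ^ (2 * l) := by
      rw [norm_mul, Complex.norm_real, Real.norm_of_nonneg (by positivity)]
    rw [Function.iterate_succ_apply', ih, neg_laplacian_waveSeries]
    · congr 1
      funext m
      push_cast
      ring
    · simpa only [hnorm] using hle (by omega)
    · simpa only [hnorm, mul_assoc, ← pow_add] using hle (by omega)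

end WaveSeries

section Fourier

open MeasureTheory

variable {n : ℕ}

/-- The cube `[0, 2π]ⁿ` over which Fourier coefficients are computed. -/
def periodCube (n : ℕ) : Set (EuclideanSpace ℝ (Fin n)) :=
  {x | ∀ i, x i ∈ Set.Icc 0 (2 * Real.pi)}

theorem toLp_preimage_periodCube :
    (WithLp.toLp 2 : (Fin n → ℝ) → EuclideanSpace ℝ (Fin n)) ⁻¹' periodCube n =
      Set.univ.pi fun _ => Set.Icc 0 (2 * Real.pi) := by
  ext x
  simp only [Set.mem_preimage, Set.mem_univ_pi]
  rfl

theorem measurableEmbedding_toLp :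
    MeasurableEmbedding (WithLp.toLp 2 : (Fin n → ℝ) → EuclideanSpace ℝ (Fin n)) :=
  (MeasurableEquiv.toLp 2 (Fin n → ℝ)).measurableEmbedding

theorem setIntegral_periodCube (f : EuclideanSpace ℝ (Fin n) → ℂ) :
    ∫ x in periodCube n, f x = ∫ x, f (WithLp.toLp 2 x)
      ∂(Measure.pi fun _ : Fin n => (volume : Measure ℝ).restrict (Set.Icc 0 (2 * Real.pi))) := by
  rw [← (PiLp.volume_preserving_toLp (Fin n)).setIntegral_preimage_emb measurableEmbedding_toLp,
    toLp_preimage_periodCube, volume_pi, Measure.restrict_pi_pi]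

theorem volume_periodCube_lt_top : volume (periodCube n) < ∞ := by
  rw [← (PiLp.volume_preserving_toLp (Fin n)).measure_preimage_emb measurableEmbedding_toLp,
    toLp_preimage_periodCube]
  exact (isCompact_univ_pi fun _ => isCompact_Icc).measure_lt_top

theorem setIntegral_exp_int_mul (b : ℤ) :
    ∫ s in Set.Icc 0 (2 * Real.pi), Complex.exp (Complex.I * ((b * s : ℝ) : ℂ)) =
      if b = 0 then ((2 * Real.pi : ℝ) : ℂ) else 0 := by
  rw [integral_Icc_eq_integral_Ioc, ← intervalIntegral.integral_of_le Real.two_pi_pos.le]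
  split_ifs with hb
  · simp [hb]
  · have hc : Complex.I * (b : ℂ) ≠ 0 := mul_ne_zero Complex.I_ne_zero (by exact_mod_cast hb)
    have hperiod : Complex.exp (Complex.I * b * ((2 * Real.pi : ℝ) : ℂ)) = 1 := by
      rw [Complex.exp_eq_one_iff]
      exact ⟨b, by push_cast; ring⟩
    have h := integral_exp_mul_complex (a := 0) (b := 2 * Real.pi) hc
    simp only [hperiod, Complex.ofReal_zero, mul_zero, Complex.exp_zero, sub_self, zero_div] at h
    rw [← h]
    refine intervalIntegral.integral_congr fun s _ => ?_
    simp [mul_assoc]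

theorem planeWave_latticePoint_toLp (b : Fin n → ℤ) (x : Fin n → ℝ) :
    planeWave (latticePoint b) (WithLp.toLp 2 x) =
      ∏ i, Complex.exp (Complex.I * ((b i * x i : ℝ) : ℂ)) := by
  rw [← Complex.exp_sum, planeWave, ← Finset.mul_sum, ← Complex.ofReal_sum]
  congr 3
  simp [latticePoint, PiLp.inner_apply, mul_comm]

theorem setIntegral_planeWave (b : Fin n → ℤ) :
    ∫ x in periodCube n, planeWave (latticePoint b) x =
      if b = 0 then (((2 * Real.pi) ^ n : ℝ) : ℂ) else 0 := by
  simp only [setIntegral_periodCube, planeWave_latticePoint_toLp]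
  rw [integral_fintype_prod_eq_prod
    (f := fun (i : Fin n) (s : ℝ) => Complex.exp (Complex.I * ((b i * s : ℝ) : ℂ)))]
  simp only [setIntegral_exp_int_mul]
  split_ifs with hb
  · simp [hb]
  · obtain ⟨i, hi⟩ := Function.ne_iff.1 hb
    exact Finset.prod_eq_zero (Finset.mem_univ i) (if_neg hi)

theorem hasSum_setIntegral_mul_planeWave {c : (Fin n → ℤ) → ℂ} (hc : Summable fun m => ‖c m‖)
    (p : (Fin n → ℤ) → EuclideanSpace ℝ (Fin n)) :
    HasSum (fun m => c m * ∫ x in periodCube n, planeWave (p m) x)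
      (∫ x in periodCube n, waveSeries c p x) := by
  have : IsFiniteMeasure (volume.restrict (periodCube n)) :=
    ⟨by rw [Measure.restrict_apply_univ]; exact volume_periodCube_lt_top⟩
  have hnorm (m : Fin n → ℤ) (x : EuclideanSpace ℝ (Fin n)) :
      ‖c m * planeWave (p m) x‖ = ‖c m‖ := by
    rw [norm_mul, norm_planeWave, mul_one]
  simp only [← integral_const_mul]
  refine hasSum_integral_of_summable_integral_norm (fun m => ?_) ?_
  · refine Integrable.of_bound (C := ‖c m‖) ?_ (Filter.Eventually.of_forall fun x => (hnorm m x).le)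
    exact (continuous_const.mul (contDiff_planeWave (N := 0) _).continuous).aestronglyMeasurable
  · simp only [hnorm, integral_const, smul_eq_mul]
    exact hc.mul_left _

theorem fourierCoefficient_waveSeries {c : (Fin n → ℤ) → ℂ} (hc : Summable fun m => ‖c m‖)
    (b : Fin n → ℤ) : fourierCoefficient (waveSeries c latticePoint) b = c b := by
  have hmul (x : EuclideanSpace ℝ (Fin n)) :
      waveSeries c latticePoint x * planeWave (-latticePoint b) x =
        waveSeries c (fun m => latticePoint (m - b)) x := by
    rw [waveSeries, ← tsum_mul_right]
    refine tsum_congr fun m => ?_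
    rw [mul_assoc, ← planeWave_add, ← sub_eq_add_neg, ← latticePoint_sub]
  have hint : ∫ x in periodCube n, waveSeries c latticePoint x * planeWave (-latticePoint b) x =
      c b * (((2 * Real.pi) ^ n : ℝ) : ℂ) := by
    simp only [hmul]
    rw [← (hasSum_setIntegral_mul_planeWave hc _).tsum_eq]
    simp only [setIntegral_planeWave, sub_eq_zero, mul_ite, mul_zero, tsum_ite_eq]
  have hpi : (((2 * Real.pi) ^ n : ℝ) : ℂ) ≠ 0 :=
    Complex.ofReal_ne_zero.2 (pow_pos Real.two_pi_pos n).ne'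
  exact (congrArg _ hint).trans (by field_simp)

theorem starNorm_waveSeries (c : ℓ¹(Fin n → ℤ, ℂ)) :
    starNorm (waveSeries c latticePoint) = ENNReal.ofReal ‖c‖ := by
  have hc := hasSum_norm_apply c
  rw [starNorm, ← hc.tsum_eq, ENNReal.ofReal_tsum_of_nonneg (fun _ => norm_nonneg _) hc.summable]
  simp only [fourierCoefficient_waveSeries hc.summable, ofReal_norm]

end Fourier

section WaveAlgebra

variable {n : ℕ} {α : Type*}

/-- Evaluation at `x` of a series of plane waves, as a functional of its coefficients. -/
def evalWave (p : α → EuclideanSpace ℝ (Fin n)) (x : EuclideanSpace ℝ (Fin n)) :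
    ℓ¹(α, ℂ) →L[ℂ] ℂ :=
  linearCombination (fun m => planeWave (p m) x) zero_le_one fun m => (norm_planeWave (p m) x).le

theorem hasSum_evalWave (c : ℓ¹(α, ℂ)) (p : α → EuclideanSpace ℝ (Fin n))
    (x : EuclideanSpace ℝ (Fin n)) : HasSum (fun m => c m * planeWave (p m) x) (evalWave p x c) :=
  hasSum_linearCombination _ _ c

theorem waveSeries_eq_evalWave (c : ℓ¹(α, ℂ)) (p : α → EuclideanSpace ℝ (Fin n))
    (x : EuclideanSpace ℝ (Fin n)) : waveSeries c p x = evalWave p x c :=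
  (hasSum_evalWave c p x).tsum_eq

theorem continuous_waveSeries (c : ℓ¹(α, ℂ)) (p : α → EuclideanSpace ℝ (Fin n)) :
    Continuous (waveSeries c p) :=
  have hc := (hasSum_norm_apply c).summable
  (contDiff_waveSeries (N := 0) hc (by simpa using hc)).continuous

theorem evalWave_single [DecidableEq α] (p : α → EuclideanSpace ℝ (Fin n))
    (x : EuclideanSpace ℝ (Fin n)) (s : α) (a : ℂ) :
    evalWave p x (lp.single 1 s a) = a * planeWave (p s) x :=
  linearCombination_single _ _ s a

theorem evalWave_shift (x : EuclideanSpace ℝ (Fin n)) (m : Fin n → ℤ) (c : ℓ¹(Fin n → ℤ, ℂ)) :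
    evalWave latticePoint x (shift m c) =
      planeWave (latticePoint m) x * evalWave latticePoint x c := by
  have h := (Equiv.addRight m).hasSum_iff.2 (hasSum_evalWave (shift m c) latticePoint x)
  refine h.unique (((hasSum_evalWave c latticePoint x).mul_left _).congr_fun fun p => ?_)
  simp only [Function.comp_apply, Equiv.coe_addRight, shift_apply, add_sub_cancel_right,
    latticePoint_add, planeWave_add]
  ring

theorem evalWave_conv (x : EuclideanSpace ℝ (Fin n)) (c c' : ℓ¹(Fin n → ℤ, ℂ)) :
    evalWave latticePoint x (conv c c') =
      evalWave latticePoint x c * evalWave latticePoint x c' := by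
  refine ((hasSum_conv c c').mapL (evalWave latticePoint x)).unique
    (((hasSum_evalWave c latticePoint x).mul_right _).congr_fun fun m => ?_)
  rw [map_smul, smul_eq_mul, evalWave_shift, mul_assoc]

theorem evalWave_conjCoeff (x : EuclideanSpace ℝ (Fin n)) (c : ℓ¹(Fin n → ℤ, ℂ)) :
    evalWave latticePoint x (conjCoeff c) = conj (evalWave latticePoint x c) := by
  have h := (Equiv.neg (Fin n → ℤ)).hasSum_iff.2 (hasSum_evalWave (conjCoeff c) latticePoint x)
  refine h.unique
    ((Complex.hasSum_conj'.2 (hasSum_evalWave c latticePoint x)).congr_fun fun m => ?_)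
  simp [conj_planeWave, latticePoint_neg]

theorem evalWave_cubic (x : EuclideanSpace ℝ (Fin n)) (c : ℓ¹(Fin n → ℤ, ℂ)) :
    evalWave latticePoint x (cubic c) =
      ((‖evalWave latticePoint x c‖ ^ 2 : ℝ) : ℂ) * evalWave latticePoint x c := by
  rw [cubic, evalWave_conv, evalWave_conv, evalWave_conjCoeff, Complex.mul_conj,
    Complex.normSq_eq_norm_sq]

theorem isPeriodic_waveSeries (c : (Fin n → ℤ) → ℂ) : IsPeriodic (waveSeries c latticePoint) := by
  intro s x
  refine tsum_congr fun m => ?_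
  rw [planeWave_add_right, planeWave_latticePoint_period, mul_one]

end WaveAlgebra

/-! ### Quasi-periodic solutions from eigenvectors in `ℓ¹` -/

section Solution

variable {n l : ℕ}

theorem isQuasiPeriodic_of_forall {t : EuclideanSpace ℝ (Fin n)}
    {u : EuclideanSpace ℝ (Fin n) → ℂ} (hu : ContDiff ℝ (2 * l : ℕ) u)
    (h : ∀ s x, u (x + EuclideanSpace.single s (2 * Real.pi)) =
      Complex.exp (2 * Real.pi * Complex.I * (t s : ℂ)) * u x) :
    IsQuasiPeriodic l t u := by
  intro s m hm x
  have hu' : ContDiff ℝ m u := hu.of_le (by exact_mod_cast hm.le)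
  rw [← iteratedFDeriv_comp_add_right, funext (h s)]
  exact DFunLike.congr_fun (iteratedFDeriv_const_smul_apply'
    (a := Complex.exp (2 * Real.pi * Complex.I * (t s : ℂ))) hu'.contDiffAt) _

/-- The Fourier coefficients of a trigonometric polynomial, as an element of `ℓ¹`. -/
def potentialCoeff (v : (Fin n → ℤ) →₀ ℂ) : ℓ¹(Fin n → ℤ, ℂ) :=
  ⟨fun m => v m, memℓp_gen (summable_of_ne_finset_zero (s := v.support) fun m hm => by
    simp [Finsupp.notMem_support_iff.1 hm])⟩

@[simp]
theorem potentialCoeff_apply (v : (Fin n → ℤ) →₀ ℂ) (m : Fin n → ℤ) : potentialCoeff v m = v m :=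
  rfl

theorem evalWave_potentialCoeff (v : (Fin n → ℤ) →₀ ℂ) (x : EuclideanSpace ℝ (Fin n)) :
    evalWave latticePoint x (potentialCoeff v) = potential v x := by
  rw [potential, Finsupp.sum]
  refine (hasSum_evalWave _ _ x).unique (hasSum_sum_of_ne_finset_zero fun m hm => ?_)
  rw [potentialCoeff_apply, Finsupp.notMem_support_iff.1 hm, zero_mul]

theorem shiftedPoint_add (j m : Fin n → ℤ) (t : EuclideanSpace ℝ (Fin n)) :
    shiftedPoint (j + m) t = latticePoint m + shiftedPoint j t := by
  rw [shiftedPoint, shiftedPoint, latticePoint_add]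
  abel

theorem planeWave_shiftedPoint_period (j : Fin n → ℤ) (t : EuclideanSpace ℝ (Fin n)) (s : Fin n) :
    planeWave (shiftedPoint j t) (EuclideanSpace.single s (2 * Real.pi)) =
      Complex.exp (2 * Real.pi * Complex.I * (t s : ℂ)) := by
  rw [shiftedPoint, planeWave_add, planeWave_latticePoint_period, one_mul, planeWave_single]
  push_cast
  ring_nf

theorem evalWave_shiftedPoint (c : ℓ¹(Fin n → ℤ, ℂ)) (j : Fin n → ℤ)
    (t x : EuclideanSpace ℝ (Fin n)) :
    evalWave (fun m => shiftedPoint (j + m) t) x c =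
      evalWave latticePoint x c * planeWave (shiftedPoint j t) x := by
  refine (hasSum_evalWave c _ x).unique
    (((hasSum_evalWave c latticePoint x).mul_right _).congr_fun fun m => ?_)
  rw [shiftedPoint_add, planeWave_add, mul_assoc]

theorem contDiff_and_polyLaplacian_of_forall {Y W : ℓ¹(Fin n → ℤ, ℂ)} {j : Fin n → ℤ}
    {t : EuclideanSpace ℝ (Fin n)} (h : ∀ m, freeEigenvalue l (j + m) t * Y m = W m) :
    ContDiff ℝ (2 * l : ℕ) (fun x => evalWave (fun m => shiftedPoint (j + m) t) x Y) ∧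
      polyLaplacian l (fun x => evalWave (fun m => shiftedPoint (j + m) t) x Y) =
        fun x => evalWave (fun m => shiftedPoint (j + m) t) x W := by
  have hY := (hasSum_norm_apply Y).summable
  have hW : Summable fun m => ‖Y m‖ * ‖shiftedPoint (j + m) t‖ ^ (2 * l) := by
    refine (hasSum_norm_apply W).summable.congr fun m => ?_
    rw [← h, norm_mul, mul_comm, Complex.norm_real, freeEigenvalue,
      Real.norm_of_nonneg (by positivity)]
  simp only [← waveSeries_eq_evalWave]
  refine ⟨contDiff_waveSeries hY hW, (polyLaplacian_waveSeries l hY hW).trans ?_⟩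
  congr 1
  funext m
  rw [← h, mul_comm, freeEigenvalue]

theorem isSolution_of_eigenvector {v : (Fin n → ℤ) →₀ ℂ} {j : Fin n → ℤ}
    {t : EuclideanSpace ℝ (Fin n)} {Y : ℓ¹(Fin n → ℤ, ℂ)} {lam σ : ℝ} {B : ℂ}
    (hY : ∀ m, freeEigenvalue l (j + m) t * Y m + conv (potentialCoeff v) Y m +
      (σ * ‖B‖ ^ 2 : ℝ) * cubic Y m = lam * Y m) :
    IsSolution l (potential v) σ lam
      (fun x => B * planeWave (shiftedPoint j t) x * waveSeries Y latticePoint x) := by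
  set W : ℓ¹(Fin n → ℤ, ℂ) := (lam : ℂ) • Y - conv (potentialCoeff v) Y -
    ((σ * ‖B‖ ^ 2 : ℝ) : ℂ) • cubic Y with hW
  have hu : (fun x => B * planeWave (shiftedPoint j t) x * waveSeries Y latticePoint x) =
      fun x => evalWave (fun m => shiftedPoint (j + m) t) x (B • Y) := by
    funext x
    rw [map_smul, evalWave_shiftedPoint, waveSeries_eq_evalWave, smul_eq_mul]
    ring
  have hfree (m : Fin n → ℤ) : freeEigenvalue l (j + m) t * (B • Y) m = (B • W) m := by
    have hWm : W m = lam * Y m - conv (potentialCoeff v) Y m -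
      (σ * ‖B‖ ^ 2 : ℝ) * cubic Y m := rfl
    rw [lp.coeFn_smul, lp.coeFn_smul, Pi.smul_apply, Pi.smul_apply, smul_eq_mul, smul_eq_mul, hWm]
    linear_combination B * hY m
  obtain ⟨hsmooth, hlap⟩ := contDiff_and_polyLaplacian_of_forall hfree
  rw [IsSolution, hu]
  refine ⟨hsmooth, fun x => ?_⟩
  rw [hlap]
  simp only [hW, waveSeries_eq_evalWave, evalWave_shiftedPoint, map_smul, map_sub, evalWave_conv,
    evalWave_cubic, evalWave_potentialCoeff, smul_eq_mul, norm_mul, norm_planeWave]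
  push_cast
  ring

theorem isQuasiPeriodic_mul_waveSeries {j : Fin n → ℤ} {t : EuclideanSpace ℝ (Fin n)} {B : ℂ}
    {c : (Fin n → ℤ) → ℂ} (h : ContDiff ℝ (2 * l : ℕ)
      (fun x => B * planeWave (shiftedPoint j t) x * waveSeries c latticePoint x)) :
    IsQuasiPeriodic l t
      (fun x => B * planeWave (shiftedPoint j t) x * waveSeries c latticePoint x) :=
  isQuasiPeriodic_of_forall h fun s x => by
    rw [planeWave_add_right, planeWave_shiftedPoint_period, isPeriodic_waveSeries c s x]
    ring

end Solution

/-! ### The two-dimensional model -/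

/-- The larger eigenvalue of a Hermitian matrix with diagonal entries `a`, `b` and off-diagonal
entries of modulus `ρ`. -/
def upperEigenvalue (a b ρ : ℝ) : ℝ :=
  (a + b) / 2 + Real.sqrt (4 * ρ ^ 2 + (a - b) ^ 2) / 2

section UpperEigenvalue

variable {a b ρ : ℝ}

theorem upperEigenvalue_sub_mul_sub (a b ρ : ℝ) :
    (upperEigenvalue a b ρ - a) * (upperEigenvalue a b ρ - b) = ρ ^ 2 := by
  have hsq := Real.sq_sqrt (by positivity : 0 ≤ 4 * ρ ^ 2 + (a - b) ^ 2)
  rw [upperEigenvalue]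
  linear_combination hsq / 4

theorem left_le_upperEigenvalue (a b ρ : ℝ) : a ≤ upperEigenvalue a b ρ := by
  have habs : |a - b| ≤ Real.sqrt (4 * ρ ^ 2 + (a - b) ^ 2) :=
    Real.abs_le_sqrt (le_add_of_nonneg_left (by positivity))
  rw [upperEigenvalue]
  linarith [le_abs_self (a - b)]

theorem upperEigenvalue_comm (a b ρ : ℝ) : upperEigenvalue a b ρ = upperEigenvalue b a ρ := by
  rw [upperEigenvalue, upperEigenvalue, add_comm a, ← neg_sub b, neg_sq]

theorem right_le_upperEigenvalue (a b ρ : ℝ) : b ≤ upperEigenvalue a b ρ :=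
  upperEigenvalue_comm a b ρ ▸ left_le_upperEigenvalue b a ρ

theorem two_mul_le_two_mul_upperEigenvalue_sub (a b ρ : ℝ) :
    2 * ρ ≤ 2 * upperEigenvalue a b ρ - a - b := by
  have hle : 2 * ρ ≤ Real.sqrt (4 * ρ ^ 2 + (a - b) ^ 2) :=
    Real.le_sqrt_of_sq_le (by nlinarith [sq_nonneg (a - b)])
  rw [upperEigenvalue]
  linarith

theorem upperEigenvalue_le (hρ : 0 ≤ ρ) : upperEigenvalue a b ρ ≤ max a b + ρ := by
  have hle : Real.sqrt (4 * ρ ^ 2 + (a - b) ^ 2) ≤ 2 * ρ + |a - b| := by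
    refine Real.sqrt_le_iff.2 ⟨by positivity, ?_⟩
    nlinarith [sq_abs (a - b), mul_nonneg hρ (abs_nonneg (a - b))]
  rw [upperEigenvalue]
  rcases le_total a b with h | h
  · rw [max_eq_right h]
    linarith [abs_of_nonpos (sub_nonpos.2 h)]
  · rw [max_eq_left h]
    linarith [abs_of_nonneg (sub_nonneg.2 h)]

end UpperEigenvalue

namespace IsUnitEigenvector

variable {α β Λ : ℝ} {b e₀ e₁ : ℂ}

theorem norm_fst_mul_le (h : IsUnitEigenvector α β b Λ e₀ e₁) (hβ : β ≤ Λ) :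
    ‖e₀‖ * (β - α) ≤ ‖b‖ :=
  have hfst : ((Λ - α : ℝ) : ℂ) * e₀ = b * e₁ := by
    push_cast
    linear_combination -h.fst
  calc ‖e₀‖ * (β - α)
    _ ≤ ‖e₀‖ * |Λ - α| := by
      gcongr
      exact (sub_le_sub_right hβ α).trans (le_abs_self _)
    _ = ‖b‖ * ‖e₁‖ := by
      rw [mul_comm, ← norm_mul, ← hfst, norm_mul, Complex.norm_real, Real.norm_eq_abs]
    _ ≤ ‖b‖ := mul_le_of_le_one_right (norm_nonneg b) h.norm_snd_le

theorem of_upperEigenvalue {r : ℝ} (hr : 0 < r)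
    (hnorm : r ^ 2 = (β - upperEigenvalue α β ‖b‖) ^ 2 + ‖b‖ ^ 2) :
    IsUnitEigenvector α β b (upperEigenvalue α β ‖b‖)
      ((β - upperEigenvalue α β ‖b‖ : ℝ) / r) (-conj b / r) := by
  have hrc : (r : ℂ) ≠ 0 := Complex.ofReal_ne_zero.2 hr.ne'
  have hprod : ((upperEigenvalue α β ‖b‖ : ℂ) - α) * (upperEigenvalue α β ‖b‖ - β) =
      b * conj b := by
    rw [Complex.mul_conj, Complex.normSq_eq_norm_sq]
    exact_mod_cast upperEigenvalue_sub_mul_sub α β ‖b‖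
  constructor
  · field_simp
    push_cast
    linear_combination hprod
  · field_simp
    push_cast
    ring
  · rw [norm_div, norm_div, norm_neg, RCLike.norm_conj, Complex.norm_real, Complex.norm_real,
      div_pow, div_pow, Real.norm_eq_abs, Real.norm_eq_abs, sq_abs, sq_abs, ← add_div, ← hnorm,
      div_self (by positivity)]

end IsUnitEigenvector

section Model

variable {n l : ℕ} {v : (Fin n → ℤ) →₀ ℂ} {q j : Fin n → ℤ} {t : EuclideanSpace ℝ (Fin n)}
  {e₀ e₁ : ℂ}

theorem lambdaPlus_eq (l : ℕ) (v : (Fin n → ℤ) →₀ ℂ) (q j : Fin n → ℤ)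
    (t : EuclideanSpace ℝ (Fin n)) : lambdaPlus l v q j t =
      upperEigenvalue (freeEigenvalue l j t) (freeEigenvalue l (j - q) t) ‖v q‖ := rfl

/-- `(e₀, e₁)` is a unit eigenvector of the model matrix for `λ̂⁺`, and `ψ₋₁` is the corresponding
column `conj e₀ (e₀, e₁)` of the projection `Ê⁺`. -/
structure IsModelEigenvector (l : ℕ) (v : (Fin n → ℤ) →₀ ℂ) (q j : Fin n → ℤ)
    (t : EuclideanSpace ℝ (Fin n)) (e₀ e₁ : ℂ) : Prop where
  isUnitEigenvector : IsUnitEigenvector (freeEigenvalue l j t) (freeEigenvalue l (j - q) t) (v q)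
    (lambdaPlus l v q j t) e₀ e₁
  psiModel_eq : ∀ x, psiModel l v q j t x = conj e₀ * (e₀ + e₁ * planeWave (-latticePoint q) x)

theorem exists_isModelEigenvector (l : ℕ) (hvq : v (-q) = conj (v q)) (hq : v q ≠ 0)
    (j : Fin n → ℤ) (t : EuclideanSpace ℝ (Fin n)) :
    ∃ e₀ e₁, IsModelEigenvector l v q j t e₀ e₁ := by
  set b : ℝ := freeEigenvalue l (j - q) t - lambdaPlus l v q j t with hb
  have hpos : 0 < b ^ 2 + ‖v q‖ ^ 2 := by positivity
  set r := Real.sqrt (b ^ 2 + ‖v q‖ ^ 2)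
  have hr : 0 < r := Real.sqrt_pos.2 hpos
  have hr2 : r ^ 2 = b ^ 2 + ‖v q‖ ^ 2 := Real.sq_sqrt hpos.le
  have hrc : (r : ℂ) ≠ 0 := Complex.ofReal_ne_zero.2 hr.ne'
  refine ⟨b / r, -conj (v q) / r, .of_upperEigenvalue hr hr2, fun x => ?_⟩
  have hsum : (∑ i, ‖modelEigenvector l v q j t i‖ ^ 2 : ℝ) = r ^ 2 := by
    rw [hr2, Fin.sum_univ_two]
    simp only [modelEigenvector, ← hb, hvq, Matrix.cons_val_zero, Matrix.cons_val_one, norm_neg,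
      RCLike.norm_conj, Complex.norm_real, Real.norm_eq_abs, sq_abs]
  rw [psiModel, modelProjection, hsum]
  simp only [modelEigenvector, ← hb, hvq, Matrix.smul_apply, Matrix.vecMulVec_apply,
    Matrix.cons_val_zero, Matrix.cons_val_one, smul_eq_mul, Pi.star_apply, RCLike.star_def,
    map_div₀, Complex.conj_ofReal]
  push_cast
  field_simp

theorem IsModelEigenvector.psiModel_eq_evalWave (h : IsModelEigenvector l v q j t e₀ e₁)
    (x : EuclideanSpace ℝ (Fin n)) :
    psiModel l v q j t x = evalWave latticePoint x (conj e₀ • pairVector 0 (-q) e₀ e₁) := by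
  rw [h.psiModel_eq, map_smul, pairVector, map_add, evalWave_single, evalWave_single,
    latticePoint_zero, planeWave_zero, latticePoint_neg, mul_one, smul_eq_mul]

theorem IsUnitEigenvector.norm_conj_smul_pairVector_le {ι : Type*} [DecidableEq ι] {s p : ι}
    {α β Λ : ℝ} {b : ℂ} (h : IsUnitEigenvector α β b Λ e₀ e₁) :
    ‖conj e₀ • pairVector s p e₀ e₁‖ ≤ 2 * ‖e₀‖ := by
  rw [norm_smul, RCLike.norm_conj, mul_comm]
  gcongr
  exact (norm_pairVector_le e₀ e₁).trans (by linarith [h.norm_fst_le, h.norm_snd_le])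

end Model

/-! ### Solutions close to the model -/

section NearModel

variable {n l : ℕ} {v : (Fin n → ℤ) →₀ ℂ} {q j : Fin n → ℤ} {t : EuclideanSpace ℝ (Fin n)}
  {σ R : ℝ} {A : ℂ} {e₀ e₁ : ℂ}

/-- There is a quasi-periodic solution which differs from `A e^{i⟨P_j(t), x⟩} ψ₋₁`, and whose
eigenvalue differs from `λ̂⁺(t)`, by at most `R`; the distance of the solutions is measured in
`‖·‖_*`, after division by `A e^{i⟨P_j(t), x⟩}`. -/
def HasSolutionNearModel (l : ℕ) (v : (Fin n → ℤ) →₀ ℂ) (q j : Fin n → ℤ)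
    (t : EuclideanSpace ℝ (Fin n)) (σ : ℝ) (A : ℂ) (R : ℝ) : Prop :=
  ∃ (u w : EuclideanSpace ℝ (Fin n) → ℂ) (lam : ℝ),
    IsSolution l (potential v) σ lam u ∧ IsQuasiPeriodic l t u ∧
    (∀ x, u x = A * planeWave (shiftedPoint j t) x * (psiModel l v q j t x + w x)) ∧
    |lam - lambdaPlus l v q j t| ≤ R ∧ Continuous w ∧ IsPeriodic w ∧
    starNorm w ≤ ENNReal.ofReal R

theorem HasSolutionNearModel.mono {R' : ℝ} (h : HasSolutionNearModel l v q j t σ A R)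
    (hR : R ≤ R') : HasSolutionNearModel l v q j t σ A R' :=
  let ⟨u, w, lam, hsol, hqp, heq, hlam, hcont, hper, hw⟩ := h
  ⟨u, w, lam, hsol, hqp, heq, hlam.trans hR, hcont, hper, hw.trans (ENNReal.ofReal_le_ofReal hR)⟩

theorem IsModelEigenvector.hasSolutionNearModel (h : IsModelEigenvector l v q j t e₀ e₁)
    {Y : ℓ¹(Fin n → ℤ, ℂ)} {β : ℂ} {lam : ℝ}
    (hY : ∀ m, freeEigenvalue l (j + m) t * Y m + conv (potentialCoeff v) Y m +
      (σ * ‖A * β‖ ^ 2 : ℝ) * cubic Y m = lam * Y m)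
    (hlam : |lam - lambdaPlus l v q j t| ≤ R)
    (hR : ‖β • Y - conj e₀ • pairVector 0 (-q) e₀ e₁‖ ≤ R) :
    HasSolutionNearModel l v q j t σ A R := by
  have hsol := isSolution_of_eigenvector hY
  refine ⟨_, waveSeries (β • Y - conj e₀ • pairVector 0 (-q) e₀ e₁ : ℓ¹(Fin n → ℤ, ℂ)) latticePoint,
    lam, hsol, isQuasiPeriodic_mul_waveSeries hsol.1, fun x => ?_, hlam, continuous_waveSeries _ _,
    isPeriodic_waveSeries _, ?_⟩
  · rw [h.psiModel_eq_evalWave, waveSeries_eq_evalWave, waveSeries_eq_evalWave, map_sub,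
      add_sub_cancel, map_smul, smul_eq_mul]
    ring
  · rw [starNorm_waveSeries]
    exact ENNReal.ofReal_le_ofReal hR

/-- The zero solution: the column `ψ₋₁` of the projection is itself small. Nothing more can be
expected, since `λ̂⁺` is then close to `p_{j-q}^{2l}`, which can coincide with a third eigenvalue of
the free operator and be split from it by the potential. -/
theorem IsModelEigenvector.hasSolutionNearModel_of_two_mul_norm_le
    (h : IsModelEigenvector l v q j t e₀ e₁)
    (hd : 0 < freeEigenvalue l (j - q) t - freeEigenvalue l j t)
    (hR : 2 * ‖v q‖ ≤ R * (freeEigenvalue l (j - q) t - freeEigenvalue l j t)) :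
    HasSolutionNearModel l v q j t σ A R := by
  have he₀ := h.isUnitEigenvector.norm_fst_mul_le (right_le_upperEigenvalue _ _ _)
  have hRe : 2 * ‖e₀‖ ≤ R := le_of_mul_le_mul_right (by linarith) hd
  have hR0 : 0 ≤ R := (by positivity : 0 ≤ 2 * ‖e₀‖).trans hRe
  refine h.hasSolutionNearModel (Y := 0) (β := 0) (lam := lambdaPlus l v q j t)
    (fun m => by simp [cubic]) (by simpa using hR0) ?_
  rw [zero_smul, zero_sub, norm_neg]
  exact h.isUnitEigenvector.norm_conj_smul_pairVector_le.trans hRe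

theorem IsUnitEigenvector.norm_smul_sub_le {ι : Type*} [DecidableEq ι] {s p : ι}
    {α β Λ κ : ℝ} {b : ℂ} (h : IsUnitEigenvector α β b Λ e₀ e₁) (hκ₀ : 0 ≤ κ) (hκ₁ : κ ≤ 1)
    (Y : ℓ¹(ι, ℂ)) :
    ‖(κ * conj e₀ : ℂ) • Y - conj e₀ • pairVector s p e₀ e₁‖ ≤
      ‖Y - pairVector s p e₀ e₁‖ + 2 * (1 - κ) := by
  set E := pairVector s p e₀ e₁
  have hE : ‖conj e₀ • E‖ ≤ 2 :=
    h.norm_conj_smul_pairVector_le.trans (by linarith [h.norm_fst_le])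
  calc ‖(κ * conj e₀ : ℂ) • Y - conj e₀ • E‖
    _ = ‖(κ * conj e₀ : ℂ) • (Y - E) - ((1 - κ : ℝ) : ℂ) • conj e₀ • E‖ := by
      push_cast
      congr 1
      module
    _ ≤ κ * ‖e₀‖ * ‖Y - E‖ + (1 - κ) * ‖conj e₀ • E‖ := by
      refine (norm_sub_le _ _).trans_eq ?_
      rw [norm_smul, norm_smul _ (conj e₀ • E), norm_mul, RCLike.norm_conj,
        Complex.norm_of_nonneg hκ₀, Complex.norm_of_nonneg (sub_nonneg.2 hκ₁)]
    _ ≤ 1 * ‖Y - E‖ + (1 - κ) * 2 := by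
      gcongr
      exact mul_le_one₀ hκ₁ (norm_nonneg _) h.norm_fst_le
    _ = ‖Y - E‖ + 2 * (1 - κ) := by ring

theorem exists_damping {S ε : ℝ} (hε : 0 < ε) (hS : 0 ≤ S) :
    ∃ κ : ℝ, 0 ≤ κ ∧ κ ≤ 1 ∧ κ ^ 2 * S ≤ ε ∧ 1 - κ ≤ S / ε := by
  rcases le_or_gt S ε with h | h
  · exact ⟨1, zero_le_one, le_rfl, by linarith, by rw [sub_self]; positivity⟩
  · have hS : 0 < S := hε.trans h
    refine ⟨Real.sqrt (ε / S), by positivity, Real.sqrt_le_one.2 ((div_le_one hS).2 h.le), ?_, ?_⟩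
    · rw [Real.sq_sqrt (by positivity), div_mul_cancel₀ _ hS.ne']
    · linarith [(one_le_div hε).2 h.le, Real.sqrt_nonneg (ε / S)]

theorem abs_mul_norm_mul_sq_le (σ : ℝ) (A : ℂ) {κ : ℝ} {e : ℂ} (hκ : 0 ≤ κ) (he : ‖e‖ ≤ 1) :
    |σ * ‖A * (κ * e)‖ ^ 2| ≤ κ ^ 2 * (|σ| * ‖A‖ ^ 2) :=
  calc |σ * ‖A * (κ * e)‖ ^ 2|
    _ = ‖e‖ ^ 2 * (κ ^ 2 * (|σ| * ‖A‖ ^ 2)) := by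
      rw [abs_mul, abs_of_nonneg (by positivity : 0 ≤ ‖A * (κ * e)‖ ^ 2), norm_mul, norm_mul,
        Complex.norm_of_nonneg hκ]
      ring
    _ ≤ κ ^ 2 * (|σ| * ‖A‖ ^ 2) :=
      mul_le_of_le_one_left (by positivity) (pow_le_one₀ (norm_nonneg e) he)

theorem error_le {C ν g S x y : ℝ} (hC : 1 ≤ C) (hν : 1 ≤ ν) (hg : 0 ≤ g) (hS : 0 ≤ S)
    (hx : x ≤ S) (hy : y ≤ 1728 * (C ^ 2 * ν) * S) :
    12 * C * ν ^ 3 * (g + 27 * x) + 2 * y ≤ 3780 * (C ^ 2 * ν ^ 3) * (g + S) :=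
  have hCν : C * ν ^ 3 ≤ C ^ 2 * ν ^ 3 := by gcongr; exact le_self_pow₀ hC two_ne_zero
  have hC2ν : C ^ 2 * ν ≤ C ^ 2 * ν ^ 3 := by gcongr; exact le_self_pow₀ hν three_ne_zero
  calc 12 * C * ν ^ 3 * (g + 27 * x) + 2 * y
    _ ≤ 12 * (C * ν ^ 3) * (g + 27 * S) + 2 * (1728 * (C ^ 2 * ν) * S) := by
      rw [← mul_assoc]
      gcongr
    _ ≤ 12 * (C ^ 2 * ν ^ 3) * (g + 27 * S) + 2 * (1728 * (C ^ 2 * ν ^ 3) * S) := by gcongr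
    _ ≤ 3780 * (C ^ 2 * ν ^ 3) * (g + S) := by
      have : 0 ≤ C ^ 2 * ν ^ 3 * g := by positivity
      linarith

theorem conjCoeff_potentialCoeff (hv_real : ∀ q, v (-q) = conj (v q)) :
    conjCoeff (potentialCoeff v) = potentialCoeff v := by
  ext m
  rw [conjCoeff_apply, potentialCoeff_apply, potentialCoeff_apply, hv_real, Complex.conj_conj]

theorem hasSolutionNearModel_of_separated (hv_zero : v 0 = 0) (hv_real : ∀ q, v (-q) = conj (v q))
    (hq : v q ≠ 0) {ν C g : ℝ} (hν : 1 ≤ ν) (hvν : ‖potentialCoeff v‖ ≤ ν) (hC : 1 ≤ C)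
    (hCv : 1 ≤ C * ‖v q‖) (hg₀ : 0 ≤ g)
    (hfar : ∀ i, i ≠ j → i ≠ j - q → 1 ≤ g * |freeEigenvalue l i t - lambdaPlus l v q j t|)
    (hg : 384 * (C ^ 2 * ν ^ 3 * g) ≤ 1) :
    HasSolutionNearModel l v q j t σ A (3780 * (C ^ 2 * ν ^ 3) * (g + |σ| * ‖A‖ ^ 2)) := by
  obtain ⟨e₀, e₁, he⟩ := exists_isModelEigenvector l (hv_real q) hq j t
  set S := |σ| * ‖A‖ ^ 2
  set ε : ℝ := 1 / (1728 * (C ^ 2 * ν)) with hε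
  -- For a strong nonlinearity the amplitude is reduced.
  obtain ⟨κ, hκ₀, hκ₁, hκε, hκS⟩ := exists_damping (S := S) (ε := ε) (by positivity) (by positivity)
  set τ : ℝ := σ * ‖A * (κ * conj e₀)‖ ^ 2
  have hτκ : |τ| ≤ κ ^ 2 * S := abs_mul_norm_mul_sq_le σ A hκ₀
    ((RCLike.norm_conj e₀).trans_le he.isUnitEigenvector.norm_fst_le)
  have hτS : |τ| ≤ S :=
    hτκ.trans (mul_le_of_le_one_left (by positivity) (pow_le_one₀ hκ₀ hκ₁))
  have hτε : 64 * (C ^ 2 * ν * (27 * |τ|)) ≤ 1 :=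
    calc 64 * (C ^ 2 * ν * (27 * |τ|)) ≤ 64 * (C ^ 2 * ν * (27 * ε)) := by
          gcongr
          exact hτκ.trans hκε
      _ = 1 := by rw [hε]; field_simp; norm_num
  have hgap : 2 ≤ C * (2 * lambdaPlus l v q j t - freeEigenvalue l (j + 0) t -
      freeEigenvalue l (j + -q) t) := by
    rw [add_zero, ← sub_eq_add_neg, lambdaPlus_eq]
    calc 2 ≤ C * (2 * ‖v q‖) := by linarith
      _ ≤ _ := by gcongr; exact two_mul_le_two_mul_upperEigenvalue_sub _ _ _
  have hq₀ : (0 : Fin n → ℤ) ≠ -q := fun h => hq (by rw [neg_eq_zero.1 h.symm, hv_zero])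
  obtain ⟨Y, lam, hY, hYE, hlam⟩ := exists_nonlinear_eigenvector (g := g) (τ := τ)
    (a := fun m => freeEigenvalue l (j + m) t) hq₀ hv_zero (conjCoeff_potentialCoeff hv_real)
    (by simpa [← sub_eq_add_neg] using he.isUnitEigenvector) hν hvν hC hgap hg₀
    (fun m hm hm' => hfar (j + m) (by simpa using hm)
      (by simpa [sub_eq_add_neg] using hm')) hg hτε
  have hbound : 12 * C * ν ^ 3 * (g + 27 * |τ|) + 2 * (1 - κ) ≤
      3780 * (C ^ 2 * ν ^ 3) * (g + S) :=
    error_le hC hν hg₀ (by positivity) hτS (hκS.trans_eq (by rw [hε]; field_simp))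
  exact he.hasSolutionNearModel hY (hlam.trans (by linarith))
    ((he.isUnitEigenvector.norm_smul_sub_le hκ₀ hκ₁ Y).trans (by linarith))

theorem norm_apply_le_norm_potentialCoeff (v : (Fin n → ℤ) →₀ ℂ) (q : Fin n → ℤ) :
    ‖v q‖ ≤ ‖potentialCoeff v‖ :=
  (congrArg _ (potentialCoeff_apply v q)).symm.trans_le (lp.norm_apply_le_norm one_ne_zero _ q)

theorem mul_abs_upperEigenvalue_sub_le {a b ρ h : ℝ} (hρ : 0 ≤ ρ) (hh : 0 ≤ h)
    (hd : 4 * h * (b - a) ≤ 1) (hhρ : 4 * (h * ρ) ≤ 1) :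
    2 * h * |upperEigenvalue a b ρ - a| ≤ 1 := by
  rw [abs_of_nonneg (sub_nonneg.2 (left_le_upperEigenvalue a b ρ))]
  calc 2 * h * (upperEigenvalue a b ρ - a)
    _ ≤ 2 * h * (max a b + ρ - a) := by gcongr; exact upperEigenvalue_le hρ
    _ = max 0 (2 * h * (b - a)) + 2 * (h * ρ) := by
      rw [← mul_zero (2 * h), ← mul_max_of_nonneg _ _ (by positivity), ← sub_self a,
        max_sub_sub_right]
      ring
    _ ≤ 1 / 2 + 1 / 2 := add_le_add (max_le (by norm_num) (by linarith)) (by linarith)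
    _ = 1 := add_halves 1

theorem hasSolutionNearModel_of_gap (hv_zero : v 0 = 0) (hv_real : ∀ q, v (-q) = conj (v q))
    (hq : v q ≠ 0) {ν C h : ℝ} (hν : 1 ≤ ν) (hvν : ‖potentialCoeff v‖ ≤ ν) (hC : 1 ≤ C)
    (hCv : 1 ≤ C * ‖v q‖) (hh : 0 ≤ h)
    (hgap : ∀ i, i ≠ j → i ≠ j - q → 1 ≤ h * |freeEigenvalue l i t - freeEigenvalue l j t|)
    (hsmall : 768 * (C ^ 2 * ν ^ 3) * h ≤ 1) :
    HasSolutionNearModel l v q j t σ A (7560 * (C ^ 2 * ν ^ 3) * (h + |σ| * ‖A‖ ^ 2)) := by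
  set M := C ^ 2 * ν ^ 3
  have hM : 0 < M := by positivity
  have hνM : ν ≤ M := (le_self_pow₀ hν three_ne_zero).trans
    (le_mul_of_one_le_left (by positivity) (one_le_pow₀ hC))
  have hqM : ‖v q‖ ≤ M := ((norm_apply_le_norm_potentialCoeff v q).trans hvν).trans hνM
  have hS : 0 ≤ M * (|σ| * ‖A‖ ^ 2) := by positivity
  rcases le_or_gt (4 * h * (freeEigenvalue l (j - q) t - freeEigenvalue l j t)) 1 with hd | hd
  · have hΛ := mul_abs_upperEigenvalue_sub_le (norm_nonneg (v q)) hh hd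
      (by linarith [mul_le_mul_of_nonneg_left hqM hh, mul_nonneg hM.le hh])
    rw [← lambdaPlus_eq] at hΛ
    have hfar : ∀ i, i ≠ j → i ≠ j - q →
        1 ≤ 2 * h * |freeEigenvalue l i t - lambdaPlus l v q j t| := fun i hi hi' => by
      have htri := mul_le_mul_of_nonneg_left (abs_sub_le (freeEigenvalue l i t)
        (lambdaPlus l v q j t) (freeEigenvalue l j t)) (by positivity : 0 ≤ 2 * h)
      linarith [hgap i hi hi']
    refine (hasSolutionNearModel_of_separated hv_zero hv_real hq hν hvν hC hCv (by positivity)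
      hfar (by linarith)).mono ?_
    linarith
  · obtain ⟨e₀, e₁, he⟩ := exists_isModelEigenvector l (hv_real q) hq j t
    have hdpos := pos_of_mul_pos_right (one_pos.trans hd) (by positivity : 0 ≤ 4 * h)
    refine he.hasSolutionNearModel_of_two_mul_norm_le hdpos ?_
    linarith [mul_lt_mul_of_pos_left hd hM, mul_nonneg hS hdpos.le]

theorem exists_one_le_forall_one_le_mul_norm {ι : Type*} (v : ι →₀ ℂ) :
    ∃ C : ℝ, 1 ≤ C ∧ ∀ q, v q ≠ 0 → 1 ≤ C * ‖v q‖ := by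
  obtain ⟨C, hC⟩ := (v.support.image fun q => ‖v q‖⁻¹).exists_le
  refine ⟨max 1 C, le_max_left _ _, fun q hq => ?_⟩
  rw [← inv_le_iff_one_le_mul₀ (norm_pos_iff.2 hq)]
  exact (hC _ (Finset.mem_image_of_mem _ (Finsupp.mem_support_iff.2 hq))).trans (le_max_right _ _)

theorem exists_hasSolutionNearModel_of_gap (hv_zero : v 0 = 0)
    (hv_real : ∀ q, v (-q) = conj (v q)) : ∃ c : ℝ, 0 < c ∧ ∀ (l : ℕ) (q : Fin n → ℤ), v q ≠ 0 →
      ∀ (j : Fin n → ℤ) (t : EuclideanSpace ℝ (Fin n)) (h : ℝ), 0 ≤ h → c * h ≤ 1 →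
      (∀ i, i ≠ j → i ≠ j - q → 1 ≤ h * |freeEigenvalue l i t - freeEigenvalue l j t|) →
      ∀ (σ : ℝ) (A : ℂ), HasSolutionNearModel l v q j t σ A (c * (h + |σ| * ‖A‖ ^ 2)) := by
  obtain ⟨C, hC, hCv⟩ := exists_one_le_forall_one_le_mul_norm v
  set ν := max 1 ‖potentialCoeff v‖
  have hν : 1 ≤ ν := le_max_left _ _
  refine ⟨7560 * (C ^ 2 * ν ^ 3), by positivity, fun l q hq j t h hh hch hgap σ A => ?_⟩
  have : 0 ≤ C ^ 2 * ν ^ 3 * h := by positivity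
  exact hasSolutionNearModel_of_gap hv_zero hv_real hq hν (le_max_right _ _) hC (hCv q hq) hh hgap
    (by linarith)

end NearModel

/-! ### Separation of the free eigenvalues -/

section Separation

theorem sub_le_abs_norm_add_sq_sub {E : Type*} [NormedAddCommGroup E] [InnerProductSpace ℝ E]
    (x y z : E) :
    |‖x‖ ^ 2 - ‖y‖ ^ 2| - 2 * (‖x - y‖ * ‖z‖) ≤ |‖x + z‖ ^ 2 - ‖y + z‖ ^ 2| := by
  have hinner : ‖x + z‖ ^ 2 - ‖y + z‖ ^ 2 = (‖x‖ ^ 2 - ‖y‖ ^ 2) + 2 * inner ℝ (x - y) z := by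
    rw [norm_add_sq_real, norm_add_sq_real, inner_sub_left]
    ring
  have hcs : |2 * inner ℝ (x - y) z| ≤ 2 * (‖x - y‖ * ‖z‖) := by
    rw [abs_mul, abs_two]
    gcongr
    exact abs_real_inner_le_norm _ _
  rw [hinner]
  linarith [abs_sub_abs_le_abs_add (‖x‖ ^ 2 - ‖y‖ ^ 2) (2 * inner ℝ (x - y) z)]

theorem le_abs_norm_add_sq_sub {E : Type*} [NormedAddCommGroup E] [InnerProductSpace ℝ E]
    {x y z : E} {ε : ℝ} (hx : 4 ≤ ‖x‖) (hz : ‖z‖ ≤ 1) (hε : ε ≤ ‖x‖) (hzε : 6 * (‖x‖ * ‖z‖) ≤ ε)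
    (hxy : 2 * ε ≤ |‖x‖ ^ 2 - ‖y‖ ^ 2|) : ε ≤ |‖x + z‖ ^ 2 - ‖y + z‖ ^ 2| := by
  refine le_trans ?_ (sub_le_abs_norm_add_sq_sub x y z)
  have hsub : ‖x - y‖ * ‖z‖ ≤ (‖x‖ + ‖y‖) * ‖z‖ := by gcongr; exact norm_sub_le x y
  rcases le_or_gt ‖y‖ (2 * ‖x‖) with hy | hy
  · have hnear : (‖x‖ + ‖y‖) * ‖z‖ ≤ (3 * ‖x‖) * ‖z‖ := by gcongr; linarith
    linarith
  · have hfar : (‖x‖ + ‖y‖) * (‖y‖ - ‖x‖) ≤ |‖x‖ ^ 2 - ‖y‖ ^ 2| := by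
      linarith [neg_abs_le (‖x‖ ^ 2 - ‖y‖ ^ 2)]
    have hunit : (‖x‖ + ‖y‖) * ‖z‖ ≤ ‖x‖ + ‖y‖ := mul_le_of_le_one_right (by positivity) hz
    have hgap : (‖x‖ + ‖y‖) * 1 ≤ (‖x‖ + ‖y‖) * (‖y‖ - ‖x‖ - 2) := by gcongr; linarith
    linarith [norm_nonneg y]

theorem pow_mul_abs_sub_le {x y : ℝ} (hx : 0 ≤ x) (hy : 0 ≤ y) (l : ℕ) :
    x ^ l * |x - y| ≤ |x ^ (l + 1) - y ^ (l + 1)| := by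
  rcases le_total y x with h | h
  · have hpow := mul_le_mul_of_nonneg_right (pow_le_pow_left₀ hy h l) hy
    rw [abs_of_nonneg (sub_nonneg.2 h), pow_succ, pow_succ]
    exact le_trans (by linarith) (le_abs_self _)
  · have hpow := mul_le_mul_of_nonneg_right (pow_le_pow_left₀ hx h l) hy
    rw [abs_of_nonpos (sub_nonpos.2 h), pow_succ, pow_succ]
    exact le_trans (by linarith) (neg_le_abs _)

theorem one_le_mul_abs_pow_sub_pow {k s x y : ℝ} {l : ℕ} (hk : 0 < k) (hl : l ≠ 0)
    (hx : k / 2 ≤ x) (hxy : k ^ s ≤ |x ^ 2 - y ^ 2|) :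
    1 ≤ 4 ^ l * k ^ (-(2 * (l : ℝ) - 2 + s)) * |x ^ (2 * l) - y ^ (2 * l)| := by
  obtain ⟨m, rfl⟩ := Nat.exists_eq_succ_of_ne_zero hl
  have hx0 : 0 < x := (half_pos hk).trans_le hx
  have hpow : (k / 2) ^ (2 * m) * k ^ s ≤ |x ^ (2 * (m + 1)) - y ^ (2 * (m + 1))| :=
    calc (k / 2) ^ (2 * m) * k ^ s
      _ ≤ (x ^ 2) ^ m * |x ^ 2 - y ^ 2| := by
        rw [← pow_mul]
        gcongr
      _ ≤ _ := by
        rw [pow_mul, pow_mul]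
        exact pow_mul_abs_sub_le (sq_nonneg x) (sq_nonneg y) m
  calc (1 : ℝ) ≤ 4 := by norm_num
    _ = 4 ^ (m + 1) * k ^ (-(2 * ((m + 1 : ℕ) : ℝ) - 2 + s)) * ((k / 2) ^ (2 * m) * k ^ s) := by
      have hexp : k ^ (-(2 * ((m + 1 : ℕ) : ℝ) - 2 + s)) = (k ^ (2 * m) * k ^ s)⁻¹ := by
        rw [← Real.rpow_natCast k (2 * m), ← Real.rpow_add hk, ← Real.rpow_neg hk.le]
        congr 1
        push_cast
        ring
      have hks : k ^ s ≠ 0 := (Real.rpow_pos_of_pos hk s).ne'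
      rw [hexp, div_pow, pow_mul 2, pow_succ]
      norm_num
      field_simp
    _ ≤ _ := by gcongr

variable {n l : ℕ} {k δ : ℝ} {i j : Fin n → ℤ} {t t₀ : EuclideanSpace ℝ (Fin n)}

theorem one_le_mul_abs_freeEigenvalue_sub (hn : 1 ≤ n) (hl : l ≠ 0) (hδ : 0 < δ) (hk : 4 ≤ k)
    (hkδ : 6 ≤ k ^ δ) (hdist : dist t t₀ < k ^ (-(n : ℝ) + 1 - 7 * δ))
    (hj : ‖shiftedPoint j t₀‖ = k) (hi : 2 * k ^ (-(n : ℝ) + 2 - 6 * δ) <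
      |‖shiftedPoint j t₀‖ ^ 2 - ‖shiftedPoint i t₀‖ ^ 2|) :
    1 ≤ 4 ^ l * k ^ (-(2 * (l : ℝ) - n - 6 * δ)) *
      |freeEigenvalue l i t - freeEigenvalue l j t| := by
  have hk₀ : 0 < k := by linarith
  have hk₁ : 1 ≤ k := by linarith
  have hn₁ : (1 : ℝ) ≤ n := by exact_mod_cast hn
  rw [dist_eq_norm] at hdist
  have hshift : ∀ m, shiftedPoint m t = shiftedPoint m t₀ + (t - t₀) := fun m => by
    rw [shiftedPoint, shiftedPoint, add_assoc, add_sub_cancel]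
  have hz : ‖t - t₀‖ ≤ 1 :=
    hdist.le.trans (Real.rpow_le_one_of_one_le_of_nonpos hk₁ (by linarith))
  have hz' : 6 * (k * ‖t - t₀‖) ≤ k ^ (-(n : ℝ) + 2 - 6 * δ) :=
    calc 6 * (k * ‖t - t₀‖) ≤ k ^ δ * (k ^ (1 : ℝ) * k ^ (-(n : ℝ) + 1 - 7 * δ)) := by
          rw [Real.rpow_one]
          gcongr
      _ = k ^ (-(n : ℝ) + 2 - 6 * δ) := by
          rw [← Real.rpow_add hk₀, ← Real.rpow_add hk₀]
          congr 1
          ring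
  have hε : k ^ (-(n : ℝ) + 2 - 6 * δ) ≤ k :=
    (Real.rpow_le_rpow_of_exponent_le hk₁ (by linarith)).trans_eq (Real.rpow_one k)
  have hsep : k ^ (-(n : ℝ) + 2 - 6 * δ) ≤ |‖shiftedPoint j t‖ ^ 2 - ‖shiftedPoint i t‖ ^ 2| := by
    rw [hshift i, hshift j]
    exact le_abs_norm_add_sq_sub (hk.trans_eq hj.symm) hz (hε.trans_eq hj.symm) (hj.symm ▸ hz')
      hi.le
  have hlow : k / 2 ≤ ‖shiftedPoint j t‖ := by
    rw [hshift j]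
    linarith [norm_le_add_norm_add (shiftedPoint j t₀) (t - t₀)]
  convert one_le_mul_abs_pow_sub_pow hk₀ hl hlow hsep using 2
  · ring_nf
  · exact abs_sub_comm _ _

theorem exists_forall_four_le_and_six_le_rpow_and_mul_rpow_neg_le {η : ℝ} (hδ : 0 < δ) (hη : 0 < η)
    (a : ℝ) : ∃ k₀ : ℝ, 1 ≤ k₀ ∧ ∀ k, k₀ < k → 4 ≤ k ∧ 6 ≤ k ^ δ ∧ a * k ^ (-η) ≤ 1 := by
  have hlim : Filter.Tendsto (fun k : ℝ => a * k ^ (-η)) Filter.atTop (nhds 0) := by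
    simpa only [mul_zero] using (tendsto_rpow_neg_atTop hη).const_mul a
  obtain ⟨k₀, hk₀⟩ := Filter.eventually_atTop.1 ((Filter.eventually_ge_atTop (4 : ℝ)).and
    (((tendsto_rpow_atTop hδ).eventually_ge_atTop 6).and (hlim.eventually_le_const one_pos)))
  exact ⟨max 1 k₀, le_max_left _ _, fun k hk => hk₀ k ((le_max_right _ _).trans hk.le)⟩

theorem rpow_neg_add_le_two_mul_rpow_neg_min {a b η s : ℝ} (hk : 1 ≤ k) (ha : a ≤ η)
    (hs : s ≤ k ^ (-b)) : k ^ (-η) + s ≤ 2 * k ^ (-min a b) :=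
  calc k ^ (-η) + s ≤ k ^ (-min a b) + k ^ (-min a b) := by
        refine add_le_add ?_ (hs.trans ?_) <;>
          refine Real.rpow_le_rpow_of_exponent_le hk (neg_le_neg ?_)
        exacts [(min_le_left _ _).trans ha, min_le_right _ _]
    _ = 2 * k ^ (-min a b) := (two_mul _).symm

end Separation

end Polyharmonic

end

open Polyharmonic in
theorem theorem3_general (n l : ℕ) (v : (Fin n → ℤ) →₀ ℂ) (hv_zero : v 0 = 0)
    (hv_real : ∀ q, v (-q) = (starRingEnd ℂ) (v q)) :
    ∃ c : ℝ, 0 < c ∧ ∀ δ : ℝ, 0 < δ → 6 * δ < 2 * (l : ℝ) - n →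
      ∃ k₀ : ℝ, 1 ≤ k₀ ∧ ∀ k : ℝ, k₀ < k →
        ∀ q : Fin n → ℤ, v q ≠ 0 →
        ∀ t t₀ : EuclideanSpace ℝ (Fin n), dist t t₀ < k ^ (-(n : ℝ) + 1 - 7 * δ) →
        ∀ j : Fin n → ℤ, ‖shiftedPoint j t₀‖ = k →
        (∀ i, i ≠ j → i ≠ j - q → 2 * k ^ (-(n : ℝ) + 2 - 6 * δ) <
          |‖shiftedPoint j t₀‖ ^ 2 - ‖shiftedPoint i t₀‖ ^ 2|) →
        ∀ (σ : ℝ) (A : ℂ), HasSolutionNearModel l v q j t σ A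
          (c * (k ^ (-(2 * (l : ℝ) - n - 6 * δ)) + |σ| * ‖A‖ ^ 2)) := by
  obtain ⟨c, hc, hsol⟩ := exists_hasSolutionNearModel_of_gap hv_zero hv_real
  refine ⟨c * 4 ^ l, by positivity, fun δ hδ hδl => ?_⟩
  obtain ⟨k₀, hk₀, hlarge⟩ := exists_forall_four_le_and_six_le_rpow_and_mul_rpow_neg_le hδ
    (sub_pos.2 hδl) (c * 4 ^ l)
  refine ⟨k₀, hk₀, fun k hk q hq t t₀ hdist j hj hfar σ A => ?_⟩
  obtain ⟨hk4, hkδ, hsmall⟩ := hlarge k hk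
  have hn : 1 ≤ n := Nat.one_le_iff_ne_zero.2 fun hn => by
    subst hn
    exact hq (Subsingleton.elim 0 q ▸ hv_zero)
  have hl : l ≠ 0 := fun hl => by
    rw [hl, Nat.cast_zero] at hδl
    linarith [Nat.cast_nonneg (α := ℝ) n]
  refine (hsol l q hq j t (4 ^ l * k ^ (-(2 * (l : ℝ) - n - 6 * δ))) (by positivity)
    (by linarith) (fun i hi hi' => one_le_mul_abs_freeEigenvalue_sub hn hl hδ hk4 hkδ hdist hj
      (hfar i hi hi')) σ A).mono ?_
  rw [mul_assoc, mul_add (4 ^ l)]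
  gcongr c * (_ + ?_)
  exact le_mul_of_one_le_left (by positivity) (one_le_pow₀ (by norm_num : (1 : ℝ) ≤ 4))

theorem theorem3 (n l : ℕ) (hln : n < 2 * l) (v : (Fin n → ℤ) →₀ ℂ) (hv_zero : v 0 = 0)
    (hv_real : ∀ q, v (-q) = (starRingEnd ℂ) (v q)) :
    ∃ c : ℝ, 0 < c ∧ ∀ δ : ℝ, 0 < δ → 9 * δ < 2 * (l : ℝ) - n →
      ∃ k₀ : ℝ, 1 ≤ k₀ ∧ ∀ k : ℝ, k₀ < k →
        ∀ q : Fin n → ℤ, v q ≠ 0 →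
        ∀ t ∈ Polyharmonic.dualCell n,
        ∀ t₀ ∈ Polyharmonic.resonantSet q k δ, dist t t₀ < k ^ (-(n : ℝ) + 1 - 7 * δ) →
        ∀ j : Fin n → ℤ, Polyharmonic.IsResonantIndex q k δ t₀ j →
        ∀ γ₂ : ℝ, 0 < γ₂ →
        ∀ (σ : ℝ) (A : ℂ), |σ| * ‖A‖ ^ 2 < k ^ (-(2 * (l : ℝ) * γ₂)) →
        ∃ (u w : EuclideanSpace ℝ (Fin n) → ℂ) (lam : ℝ),
          Polyharmonic.IsSolution l (Polyharmonic.potential v) σ lam u ∧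
          Polyharmonic.IsQuasiPeriodic l t u ∧
          (∀ x, u x = A * Polyharmonic.planeWave (Polyharmonic.shiftedPoint j t) x *
            (Polyharmonic.psiModel l v q j t x + w x)) ∧
          |lam - Polyharmonic.lambdaPlus l v q j t| ≤
            c * k ^ (-(min ((2 * (l : ℝ) - n) / 2 - 4 * δ) (2 * (l : ℝ) * γ₂))) ∧
          Continuous w ∧ Polyharmonic.IsPeriodic w ∧
          Polyharmonic.starNorm w ≤ ENNReal.ofReal
            (c * k ^ (-(min ((2 * (l : ℝ) - n) / 2 - 4 * δ) (2 * (l : ℝ) * γ₂)))) := by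
  obtain ⟨c, hc, hsol⟩ := theorem3_general n l v hv_zero hv_real
  refine ⟨c * 2, by positivity, fun δ hδ hδl => ?_⟩
  obtain ⟨k₀, hk₀, hsol⟩ := hsol δ hδ (by linarith)
  refine ⟨k₀, hk₀, fun k hk q hq t _ t₀ _ hdist j hj γ₂ _ σ A hσ =>
    (hsol k hk q hq t t₀ hdist j hj.norm_eq hj.far σ A).mono ?_⟩
  rw [mul_assoc]
  gcongr
  exact Polyharmonic.rpow_neg_add_le_two_mul_rpow_neg_min (hk₀.trans hk.le) (by linarith) hσ.le
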